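/- Let $k$ be a commutative ring and let $A=A_{\bar 0}\oplus A_{\bar 1}$ be a $k$-superalgebra (an associative unital $k$-algebra with an even multiplication) that is finitely generated and free as a $k$-module. **Conventions.** A right $A$-supermodule is a right $A$-module $M=M_{\bar 0}\oplus M_{\bar 1}$ over $k$ with $M_iA_j\subseteq M_{i+j}$; $\mathrm{Hom}_A(M,N)$ consists of all right $A$-linear maps, and is a $k$-supermodule in which $\varphi$ has parity $e$ if $\varphi(M_a)\subseteq N_{a+e}$. Let $\mathcal V_A$ be the category of finitely generated right $A$-supermodules that are projective with respect to even maps (even maps out of them lift through even surjections), and let $\mathcal E_A\subseteq\mathcal V_A$ be the full subcategory of those $M$ that are evenly generated, i.e. admit an even surjection $A^r\to M$ for some $r$. Let $\mathcal V_k$ be the category of finitely generated projective $k$-supermodules and all $k$-linear maps. Let $\Pi A$ denote $A$ with the opposite grading, and put $A^{m|n}=A^m\oplus(\Pi A)^n$, $M_{m|n}(A)=\mathrm{End}_A(A^{m|n})$, $M_n(A)=\mathrm{End}_A(A^n)$. For a $k$-supermodule $M$ and $d\ge 0$, $\Gamma^dM=(M^{\otimes d})^{\mathfrak S_d}$ is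 the supermodule of invariants of the action in which the adjacent transposition $(i\ i{+}1)$ acts on homogeneous tensors by exchanging $v_i$ and $v_{i+1}$ with the sign $(-1)^{\bar v_i\bar v_{i+1}}$; in particular $\Gamma^0M=k$. For a category $\mathcal C$ enriched in $k$-supermodules, $\Gamma^d\mathcal C$ has the same objects, morphisms $\Gamma^d\mathrm{Hom}_{\mathcal C}(X,Y)$, and composition induced factorwise from that of $\mathcal C$ with the rule of signs. Likewise, for a superalgebra $B$, $\Gamma^dB$ is a superalgebra (a subsuperalgebra of $B^{\otimes d}$), and $S^A(m|n,d)=\Gamma^dM_{m|n}(A)$, $S^A(n,d)=\Gamma^dM_n(A)$. Let $\mathbf{rep}\,\Gamma^d\mathcal C$ be the category of even $k$-linear functors $F:\Gamma^d\mathcal C\to\mathcal V_k$, whose morphisms $\eta:F\to G$ are families $\eta(X)=\eta_{\bar 0}(X)+\eta_{\bar 1}(X)$ of $k$-linear maps $F(X)\to G(X)$, with $\eta_j(X)$ of parity $j$, such that $G(\varphi)\,\eta_j(X)=(-1)^{ij}\,\eta_j(Y)\,F(\varphi)$ for every morphism $\varphi:X\to Y$ of parity $i$. For a superalgebra $E$,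 let $E\text{-}\mathbf{mod}$ be the category of left $E$-supermodules that are finitely generated and projective over $k$, whose morphisms are the $k$-linear maps $f=f_{\bar 0}+f_{\bar 1}$, with $f_j$ of parity $j$, such that $f_j(av)=(-1)^{ij}a f_j(v)$ for $a\in E$ of parity $i$. **Theorem.** Let $m,n,d$ be nonnegative integers with $m\ge d$ and $n\ge d$. (i) The evaluation functor $F\mapsto F(A^{m|n})$ is an equivalence of categories $$\mathbf{rep}\,\Gamma^d\mathcal V_A\ \xrightarrow{\ \sim\ }\ S^A(m|n,d)\text{-}\mathbf{mod}.$$ (ii) The evaluation functor $F\mapsto F(A^n)$ is an equivalence of categories $$\mathbf{rep}\,\Gamma^d\mathcal E_A\ \xrightarrow{\ \sim\ }\ S^A(n,d)\text{-}\mathbf{mod}.$$ Both functors are even and $k$-linear, and every object of the target is isomorphic to an object of the image through an even isomorphism. -/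

import Mathlib

universe u v w

set_option linter.unusedVariables false
set_option linter.unusedSectionVars false

noncomputable section

namespace SuperPoly

open CategoryTheory

/-! ### Supermodules -/

/-- A supermodule structure: a decomposition `M = M₀ ⊕ M₁` of a `k`-module indexed by `ℤ/2`. -/
class Supermodule (k : Type*) [CommRing k] (M : Type*) [AddCommGroup M] [Module k M] where
  part : ZMod 2 → Submodule k M
  isCompl : IsCompl (part 0) (part 1)

/-- `M_i`, the submodule of homogeneous elements of parity `i`. -/
abbrev part (k : Type*) [CommRing k] {M : Type*} [AddCommGroup M] [Module k M] [Supermodule k M]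
    (i : ZMod 2) : Submodule k M := Supermodule.part i

/-- The sign `(-1)^z` for `z ∈ ℤ/2`. -/
def sgn (k : Type*) [CommRing k] (z : ZMod 2) : k := (-1) ^ z.val

section Basic

variable {k : Type*} [CommRing k]

theorem zmod2_cases (i : ZMod 2) : i = 0 ∨ i = 1 := by
  revert i; decide

theorem zmod2_add_self (i : ZMod 2) : i + i = 0 := by
  revert i; decide

@[simp] theorem sgn_zero : sgn k 0 = 1 := by simp [sgn]

theorem sgn_add (x y : ZMod 2) : sgn k (x + y) = sgn k x * sgn k y := by
  have h : (1 : ZMod 2) + 1 = 0 := by decide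
  have h1 : (1 : ZMod 2).val = 1 := by decide
  rcases zmod2_cases x with rfl | rfl <;> rcases zmod2_cases y with rfl | rfl <;>
    simp [sgn, h, h1]

theorem sgn_mul_self (x : ZMod 2) : sgn k x * sgn k x = 1 := by
  rw [← sgn_add, zmod2_add_self, sgn_zero]

variable {M : Type*} [AddCommGroup M] [Module k M]

theorem isCompl_part [Supermodule k M] (i : ZMod 2) :
    IsCompl (part k i : Submodule k M) (part k (i + 1)) := by
  rcases zmod2_cases i with rfl | rfl
  · exact Supermodule.isCompl
  · exact Supermodule.isCompl.symm

/-- The projection of a supermodule onto its component of parity `i`. -/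
def proj (k : Type*) [CommRing k] {M : Type*} [AddCommGroup M] [Module k M] [Supermodule k M]
    (i : ZMod 2) : M →ₗ[k] M :=
  Submodule.projection (part k i) (part k (i + 1)) (isCompl_part i)

theorem proj_mem [Supermodule k M] (i : ZMod 2) (m : M) : proj k i m ∈ part k (M := M) i :=
  Submodule.projection_apply_mem _ _

theorem proj_of_mem [Supermodule k M] {i : ZMod 2} {m : M} (h : m ∈ part k (M := M) i) :
    proj k i m = m :=
  Submodule.projection_apply_of_mem_left _ h

theorem proj_of_mem_ne [Supermodule k M] {i j : ZMod 2} {m : M} (h : m ∈ part k (M := M) j)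
    (hij : i ≠ j) : proj k i m = 0 := by
  have : j = i + 1 := by
    rcases zmod2_cases i with rfl | rfl <;> rcases zmod2_cases j with rfl | rfl <;>
      first | rfl | exact absurd rfl hij
  subst this
  exact (Submodule.projection_apply_eq_zero_iff _).2 h

theorem proj_zero_add_proj_one [Supermodule k M] (m : M) : proj k 0 m + proj k 1 m = m := by
  have := Submodule.projection_add_projection_eq_self (isCompl_part (k := k) (M := M) 0) m
  exact this

theorem sum_proj [Supermodule k M] (m : M) : ∑ i : ZMod 2, proj k i m = m := by
  rw [show (Finset.univ : Finset (ZMod 2)) = {0, 1} by decide, Finset.sum_pair (by decide)]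
  exact proj_zero_add_proj_one m

theorem proj_proj [Supermodule k M] (i j : ZMod 2) (m : M) :
    proj k i (proj k j m) = if i = j then proj k j m else 0 := by
  split_ifs with h
  · subst h; exact proj_of_mem (proj_mem _ _)
  · exact proj_of_mem_ne (proj_mem _ _) h

theorem mem_part_iff [Supermodule k M] {i : ZMod 2} {m : M} :
    m ∈ part k (M := M) i ↔ proj k i m = m :=
  ⟨proj_of_mem, fun h => h ▸ proj_mem _ _⟩

@[elab_as_elim]
theorem hom_induction [Supermodule k M] {P : M → Prop} (m : M)
    (hadd : ∀ x y, P x → P y → P (x + y))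
    (h : ∀ (i : ZMod 2) (x : M), x ∈ part k (M := M) i → P x) : P m := by
  rw [← proj_zero_add_proj_one (k := k) m]
  exact hadd _ _ (h _ _ (proj_mem _ _)) (h _ _ (proj_mem _ _))

/-- A family of submodules together with matching projections decomposes the module. -/
theorem isCompl_of_proj (S : ZMod 2 → Submodule k M) (p : ZMod 2 → M → M)
    (hp : ∀ i m, p i m ∈ S i) (h1 : ∀ i m, m ∈ S i → p i m = m)
    (h0 : ∀ i j m, m ∈ S j → i ≠ j → p i m = 0)
    (hs : ∀ m, p 0 m + p 1 m = m) : IsCompl (S 0) (S 1) := by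
  constructor
  · rw [Submodule.disjoint_def]
    intro x hx hx'
    rw [← h1 0 x hx]
    exact h0 0 1 x hx' (by decide)
  · rw [codisjoint_iff, eq_top_iff]
    intro x _
    rw [← hs x]
    exact Submodule.add_mem_sup (hp _ _) (hp _ _)

/-- The projections are determined by the parts. -/
theorem proj_unique [Supermodule k M] {m m0 m1 : M} (h0 : m0 ∈ part k (M := M) 0)
    (h1 : m1 ∈ part k (M := M) 1) (h : m = m0 + m1) : proj k 0 m = m0 ∧ proj k 1 m = m1 := by
  subst h
  constructor
  · rw [map_add, proj_of_mem h0, proj_of_mem_ne h1 (by decide), add_zero]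
  · rw [map_add, proj_of_mem h1, proj_of_mem_ne h0 (by decide), zero_add]

/-- A map of parity `i` commutes with the projections up to a shift by `i`. -/
theorem proj_map [Supermodule k M] {N : Type*} [AddCommGroup N] [Module k N] [Supermodule k N]
    (i : ZMod 2) (f : M → N) (hadd : ∀ x y, f (x + y) = f x + f y)
    (hf : ∀ (j : ZMod 2) (x : M), x ∈ part k (M := M) j → f x ∈ part k (M := N) (j + i))
    (j : ZMod 2) (m : M) : proj k (j + i) (f m) = f (proj k j m) := by
  have h0 : f 0 = 0 := by simpa using hadd 0 0
  refine hom_induction (k := k) (P := fun m => proj k (j + i) (f m) = f (proj k j m)) m ?_ ?_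
  · intro x y hx hy
    rw [hadd, map_add, hx, hy, map_add, hadd]
  · intro l x hx
    by_cases h : j = l
    · subst h
      rw [proj_of_mem hx, proj_of_mem (hf _ _ hx)]
    · rw [proj_of_mem_ne hx h, h0]
      exact proj_of_mem_ne (hf _ _ hx) (fun h' => h (add_right_cancel h'))

/-- A submodule stable under the projections inherits the grading. -/
@[reducible]
def subSupermodule [Supermodule k M] (H : Submodule k M)
    (hH : ∀ i m, m ∈ H → proj k i m ∈ H) : Supermodule k H where
  part i := (part k i : Submodule k M).comap H.subtype
  isCompl := isCompl_of_proj (fun i => (part k i : Submodule k M).comap H.subtype)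
    (fun i m => ⟨proj k i m.1, hH i m.1 m.2⟩)
    (fun i m => proj_mem i m.1)
    (fun i m hm => Subtype.ext (proj_of_mem hm))
    (fun i j m hm hij => Subtype.ext (proj_of_mem_ne (M := M) hm hij))
    (fun m => Subtype.ext (proj_zero_add_proj_one m.1))

/-- A product of supermodules, graded componentwise. -/
instance piSupermodule {ι : Type*} {N : ι → Type*} [∀ i, AddCommGroup (N i)]
    [∀ i, Module k (N i)] [∀ i, Supermodule k (N i)] : Supermodule k (∀ i, N i) where
  part e := Submodule.pi Set.univ fun i => (part k e : Submodule k (N i))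
  isCompl := isCompl_of_proj (fun e => Submodule.pi Set.univ fun i => (part k e : Submodule k (N i)))
    (fun e m i => proj k e (m i))
    (fun e m i _ => proj_mem e (m i))
    (fun e m hm => funext fun i => proj_of_mem (hm i trivial))
    (fun e j m hm hij => funext fun i => proj_of_mem_ne (hm i trivial) hij)
    (fun m => funext fun i => proj_zero_add_proj_one (m i))

theorem mem_part_pi {ι : Type*} {N : ι → Type*} [∀ i, AddCommGroup (N i)]
    [∀ i, Module k (N i)] [∀ i, Supermodule k (N i)] {e : ZMod 2} {m : ∀ i, N i} :
    m ∈ part k (M := ∀ i, N i) e ↔ ∀ i, m i ∈ part k (M := N i) e :=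
  ⟨fun h i => h i trivial, fun h i _ => h i⟩

theorem proj_pi {ι : Type*} {N : ι → Type*} [∀ i, AddCommGroup (N i)]
    [∀ i, Module k (N i)] [∀ i, Supermodule k (N i)] (e : ZMod 2) (m : ∀ i, N i) (i : ι) :
    proj k e m i = proj k e (m i) := by
  have h := proj_map (k := k) 0 (fun m : (∀ i, N i) => m i) (fun _ _ => rfl)
    (fun j x hx => by simpa using mem_part_pi.1 hx i) e m
  simpa using h.symm

end Basic

/-! ### Homomorphisms -/

/-- `k` is a supermodule concentrated in degree `0`. -/
instance selfSupermodule (k : Type*) [CommRing k] : Supermodule k k where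
  part i := if i = 0 then ⊤ else ⊥
  isCompl := by simpa using isCompl_top_bot

/-- The action of a `ℤ/2`-graded ring `R` on `M` is graded: `R_i M_j ⊆ M_{i+j}`. -/
class GradedAction (k R M : Type*) [CommRing k] [Ring R] [Algebra k R] [AddCommGroup M]
    [Module k M] [Module R M] [Supermodule k R] [Supermodule k M] : Prop where
  smul_mem : ∀ (i j : ZMod 2) (r : R) (m : M), r ∈ part k (M := R) i → m ∈ part k (M := M) j →
    r • m ∈ part k (M := M) (i + j)

instance (k M : Type*) [CommRing k] [AddCommGroup M] [Module k M] [Supermodule k M] :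
    GradedAction k k M where
  smul_mem i j r m hr hm := by
    rcases zmod2_cases i with rfl | rfl
    · rw [zero_add]; exact Submodule.smul_mem _ _ hm
    · have : r = 0 := by simpa [part, Supermodule.part] using hr
      subst this
      rw [zero_smul]; exact Submodule.zero_mem _

section Hom

variable {k R M N P : Type*} [CommRing k] [Ring R] [Algebra k R] [Supermodule k R]
  [AddCommGroup M] [Module k M] [Module R M] [IsScalarTower k R M] [Supermodule k M]
  [AddCommGroup N] [Module k N] [Module R N] [IsScalarTower k R N] [Supermodule k N]
  [AddCommGroup P] [Module k P] [Module R P] [IsScalarTower k R P] [Supermodule k P]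

theorem proj_smul [GradedAction k R M] {i : ZMod 2} {r : R} (hr : r ∈ part k (M := R) i)
    (j : ZMod 2) (m : M) : proj k (j + i) (r • m) = r • proj k j m :=
  proj_map i (fun m => r • m) (smul_add r)
    (fun j x hx => by rw [add_comm]; exact GradedAction.smul_mem i j r x hr hx) j m

/-- The homogeneous component of parity `e` of an `R`-linear map. -/
def homComp [GradedAction k R M] [GradedAction k R N] (e : ZMod 2) (f : M →ₗ[R] N) :
    M →ₗ[R] N where
  toFun m := ∑ a : ZMod 2, proj k (a + e) (f (proj k a m))
  map_add' x y := by simp [Finset.sum_add_distrib]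
  map_smul' r m := by
    refine hom_induction (k := k) (P := fun r => ∑ a : ZMod 2, proj k (a + e) (f (proj k a (r • m))) =
        (RingHom.id R) r • ∑ a : ZMod 2, proj k (a + e) (f (proj k a m))) r ?_ ?_
    · intro x y hx hy
      simp only [RingHom.id_apply] at hx hy ⊢
      simp only [add_smul, map_add, Finset.sum_add_distrib, hx, hy]
    · intro i r hr
      simp only [RingHom.id_apply]
      rw [Finset.smul_sum, ← Equiv.sum_comp (Equiv.addRight i)]
      refine Finset.sum_congr rfl fun a _ => ?_
      simp only [Equiv.coe_addRight]
      rw [proj_smul hr, map_smul, add_right_comm, proj_smul hr]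

/-- `Hom_R(M, N)` (all `R`-linear maps) as a supermodule: a map has parity `e` when it sends
`M_a` into `N_{a+e}`. -/
instance homSupermodule [GradedAction k R M] [GradedAction k R N] :
    Supermodule k (M →ₗ[R] N) where
  part e :=
    { carrier := {f | ∀ (a : ZMod 2) (m : M), m ∈ part k (M := M) a →
        f m ∈ part k (M := N) (a + e)}
      add_mem' := fun hf hg a m hm => Submodule.add_mem _ (hf a m hm) (hg a m hm)
      zero_mem' := fun a m _ => Submodule.zero_mem _
      smul_mem' := fun c f hf a m hm => Submodule.smul_mem _ c (hf a m hm) }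
  isCompl := by
    refine isCompl_of_proj (k := k) (M := M →ₗ[R] N) (fun e =>
      { carrier := {f | ∀ (a : ZMod 2) (m : M), m ∈ part k (M := M) a →
          f m ∈ part k (M := N) (a + e)}
        add_mem' := fun hf hg a m hm => Submodule.add_mem _ (hf a m hm) (hg a m hm)
        zero_mem' := fun a m _ => Submodule.zero_mem _
        smul_mem' := fun c f hf a m hm => Submodule.smul_mem _ c (hf a m hm) })
      (fun e f => homComp (k := k) e f) ?_ ?_ ?_ ?_
    · intro e f a m hm
      change ∑ b : ZMod 2, proj k (b + e) (f (proj k b m)) ∈ part k (M := N) (a + e)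
      refine Submodule.sum_mem _ fun b _ => ?_
      by_cases h : b = a
      · subst h; exact proj_mem _ _
      · rw [proj_of_mem_ne (k := k) hm h, map_zero, map_zero]; exact Submodule.zero_mem _
    · intro e f hf
      ext m
      change ∑ a : ZMod 2, proj k (a + e) (f (proj k a m)) = f m
      have h : ∀ a : ZMod 2, proj k (a + e) (f (proj k a m)) = f (proj k a m) :=
        fun a => proj_of_mem (hf a _ (proj_mem a m))
      simp_rw [h]
      rw [← map_sum, sum_proj]
    · intro e e' f hf hne
      ext m
      change ∑ a : ZMod 2, proj k (a + e) (f (proj k a m)) = 0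
      refine Finset.sum_eq_zero fun a _ => ?_
      exact proj_of_mem_ne (hf a _ (proj_mem a m)) (fun h => hne (add_left_cancel h))
    · intro f
      ext m
      change ∑ a : ZMod 2, proj k (a + 0) (f (proj k a m)) +
        ∑ a : ZMod 2, proj k (a + 1) (f (proj k a m)) = f m
      rw [← Finset.sum_add_distrib]
      have : ∀ a : ZMod 2, proj k (a + 0) (f (proj k a m)) + proj k (a + 1) (f (proj k a m)) =
          f (proj k a m) := by
        intro a
        rcases zmod2_cases a with rfl | rfl
        · simpa using proj_zero_add_proj_one (f (proj k 0 m))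
        · rw [add_comm]; exact proj_zero_add_proj_one (f (proj k 1 m))
      rw [Finset.sum_congr rfl fun a _ => this a, ← map_sum, sum_proj]

theorem mem_part_hom [GradedAction k R M] [GradedAction k R N] {e : ZMod 2} {f : M →ₗ[R] N} :
    f ∈ part k (M := M →ₗ[R] N) e ↔ ∀ (a : ZMod 2) (m : M), m ∈ part k (M := M) a →
      f m ∈ part k (M := N) (a + e) := Iff.rfl

theorem id_mem_part_hom [GradedAction k R M] :
    (LinearMap.id : M →ₗ[R] M) ∈ part k (M := M →ₗ[R] M) 0 := by
  intro a m hm; simpa using hm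

theorem comp_mem_part_hom [GradedAction k R M] [GradedAction k R N] [GradedAction k R P]
    {i j : ZMod 2} {f : M →ₗ[R] N} {g : N →ₗ[R] P}
    (hf : f ∈ part k (M := M →ₗ[R] N) i) (hg : g ∈ part k (M := N →ₗ[R] P) j) :
    g.comp f ∈ part k (M := M →ₗ[R] P) (i + j) := by
  intro a m hm; rw [← add_assoc]; exact hg _ _ (hf _ _ hm)

end Hom

/-! ### Tensor powers, the supertwist, and divided powers -/

/-- The tensor power `M^{⊗d}`. -/
abbrev TPow (k : Type*) [CommRing k] (d : ℕ) (M : Type*) [AddCommGroup M] [Module k M] : Type _ :=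
  PiTensorProduct k (fun _ : Fin d => M)

section TPow

variable {k : Type*} [CommRing k] {d : ℕ}
variable {M : Type*} [AddCommGroup M] [Module k M] [Supermodule k M]
variable {N : Type*} [AddCommGroup N] [Module k N] [Supermodule k N]
variable {L : Type*} [AddCommGroup L] [Module k L] [Supermodule k L]

/-- The projection of `M^{⊗d}` onto `M_{ε 1} ⊗ ⋯ ⊗ M_{ε d}`. -/
def tproj (k : Type*) [CommRing k] {d : ℕ} {M : Type*} [AddCommGroup M] [Module k M]
    [Supermodule k M] (ε : Fin d → ZMod 2) : TPow k d M →ₗ[k] TPow k d M :=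
  PiTensorProduct.map fun i => proj k (ε i)

theorem tproj_tprod (ε : Fin d → ZMod 2) (v : Fin d → M) :
    tproj k ε (PiTensorProduct.tprod k v) = PiTensorProduct.tprod k fun i => proj k (ε i) (v i) :=
  PiTensorProduct.map_tprod _ _

theorem tprod_eq_sum (v : Fin d → M) :
    PiTensorProduct.tprod k v =
      ∑ ε : Fin d → ZMod 2, PiTensorProduct.tprod k fun i => proj k (ε i) (v i) := by
  have h := (PiTensorProduct.tprod k (s := fun _ : Fin d => M)).map_sum
    (fun i (e : ZMod 2) => proj k e (v i))
  rw [← h]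
  congr 1
  ext i
  exact (sum_proj _).symm

/-- Tensors of homogeneous vectors generate. -/
theorem tpow_induction {P : TPow k d M → Prop} (x : TPow k d M)
    (hadd : ∀ x y, P x → P y → P (x + y)) (hsmul : ∀ (c : k) x, P x → P (c • x))
    (h : ∀ (ε : Fin d → ZMod 2) (v : Fin d → M), (∀ i, v i ∈ part k (M := M) (ε i)) →
      P (PiTensorProduct.tprod k v)) : P x := by
  have h0 : P 0 := by
    have := hsmul 0 _ (h 0 0 (fun i => Submodule.zero_mem _))
    rwa [zero_smul] at this
  induction x using PiTensorProduct.induction_on with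
  | smul_tprod c v =>
    refine hsmul _ _ ?_
    rw [tprod_eq_sum]
    refine Finset.sum_induction _ P hadd h0 fun ε _ => ?_
    exact h ε _ fun i => proj_mem _ _
  | add x y hx hy => exact hadd _ _ hx hy

theorem tproj_of_hom {ε : Fin d → ZMod 2} {v : Fin d → M}
    (hv : ∀ i, v i ∈ part k (M := M) (ε i)) (ε' : Fin d → ZMod 2) :
    tproj k ε' (PiTensorProduct.tprod k v) =
      if ε' = ε then PiTensorProduct.tprod k v else 0 := by
  rw [tproj_tprod]
  split_ifs with h
  · subst h
    congr 1
    ext i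
    exact proj_of_mem (hv i)
  · obtain ⟨i, hi⟩ := Function.ne_iff.1 h
    exact (PiTensorProduct.tprod k).map_coord_zero i (proj_of_mem_ne (hv i) hi)

/-- The component of `M^{⊗d}` of total parity `e`. -/
def tpowPart (k : Type*) [CommRing k] (d : ℕ) (M : Type*) [AddCommGroup M] [Module k M]
    [Supermodule k M] (e : ZMod 2) : Submodule k (TPow k d M) :=
  Submodule.span k {x | ∃ (ε : Fin d → ZMod 2) (v : Fin d → M),
    (∀ i, v i ∈ part k (M := M) (ε i)) ∧ ∑ i, ε i = e ∧ x = PiTensorProduct.tprod k v}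

/-- The projection onto the component of total parity `e`. -/
def tpowProj (k : Type*) [CommRing k] (d : ℕ) (M : Type*) [AddCommGroup M] [Module k M]
    [Supermodule k M] (e : ZMod 2) : TPow k d M →ₗ[k] TPow k d M :=
  ∑ ε : Fin d → ZMod 2, if ∑ i, ε i = e then tproj k ε else 0

theorem tpowProj_of_hom {ε : Fin d → ZMod 2} {v : Fin d → M}
    (hv : ∀ i, v i ∈ part k (M := M) (ε i)) (e : ZMod 2) :
    tpowProj k d M e (PiTensorProduct.tprod k v) =
      if ∑ i, ε i = e then PiTensorProduct.tprod k v else 0 := by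
  rw [tpowProj, LinearMap.sum_apply, Finset.sum_eq_single ε]
  · split_ifs
    · rw [tproj_of_hom hv, if_pos rfl]
    · rfl
  · intro ε' _ hne
    split_ifs
    · rw [tproj_of_hom hv, if_neg hne]
    · rfl
  · intro h; exact absurd (Finset.mem_univ _) h

theorem tpowProj_of_mem (i : ZMod 2) (j : ZMod 2) (m : TPow k d M) (hm : m ∈ tpowPart k d M j) :
    tpowProj k d M i m = if j = i then m else 0 := by
  induction hm using Submodule.span_induction with
  | mem x hx =>
    obtain ⟨ε, v, hv, rfl, rfl⟩ := hx
    exact tpowProj_of_hom hv i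
  | zero => simp
  | add x y _ _ hx hy => rw [map_add, hx, hy]; split_ifs <;> simp
  | smul c x _ hx => rw [map_smul, hx]; split_ifs <;> simp

/-- The grading of `M^{⊗d}` by total parity. -/
instance tpowSupermodule : Supermodule k (TPow k d M) where
  part e := tpowPart k d M e
  isCompl := by
    refine isCompl_of_proj (fun e => tpowPart k d M e) (fun e x => tpowProj k d M e x) ?_ ?_ ?_ ?_
    · intro e x
      refine tpow_induction (P := fun x => tpowProj k d M e x ∈ tpowPart k d M e) x ?_ ?_ ?_
      · intro x y hx hy; rw [map_add]; exact Submodule.add_mem _ hx hy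
      · intro c x hx; rw [map_smul]; exact Submodule.smul_mem _ c hx
      · intro ε v hv
        rw [tpowProj_of_hom hv]
        split_ifs with h
        · exact Submodule.subset_span ⟨ε, v, hv, h, rfl⟩
        · exact Submodule.zero_mem _
    · intro i m hm; rw [tpowProj_of_mem i i m hm, if_pos rfl]
    · intro i j m hm hij; rw [tpowProj_of_mem i j m hm, if_neg hij.symm]
    · intro x
      refine tpow_induction (P := fun x => tpowProj k d M 0 x + tpowProj k d M 1 x = x) x ?_ ?_ ?_
      · intro x y hx hy
        rw [map_add, map_add, add_add_add_comm, hx, hy]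
      · intro c x hx
        rw [map_smul, map_smul, ← smul_add, hx]
      · intro ε v hv
        rw [tpowProj_of_hom hv, tpowProj_of_hom hv]
        rcases zmod2_cases (∑ i, ε i) with h | h <;> simp [h]

theorem tprod_mem_part {ε : Fin d → ZMod 2} {v : Fin d → M}
    (hv : ∀ i, v i ∈ part k (M := M) (ε i)) :
    PiTensorProduct.tprod k v ∈ part k (M := TPow k d M) (∑ i, ε i) :=
  Submodule.subset_span ⟨ε, v, hv, rfl, rfl⟩

/-- The supertwist of the tensor factors `r` and `s`: on homogeneous vectors
`v₁ ⊗ ⋯ ⊗ v_d ↦ (-1)^{|v_r||v_s|} (v₁ ⊗ ⋯ ⊗ v_d with factors r and s exchanged)`.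
It is used for adjacent factors only, where this is the sign of the supertwist. -/
def superSwap (k : Type*) [CommRing k] {d : ℕ} (M : Type*) [AddCommGroup M] [Module k M]
    [Supermodule k M] (r s : Fin d) : TPow k d M →ₗ[k] TPow k d M :=
  ∑ ε : Fin d → ZMod 2, sgn k (ε r * ε s) •
    ((PiTensorProduct.reindex k (fun _ : Fin d => M) (Equiv.swap r s)).toLinearMap ∘ₗ tproj k ε)

theorem superSwap_tprod {ε : Fin d → ZMod 2} {v : Fin d → M}
    (hv : ∀ i, v i ∈ part k (M := M) (ε i)) (r s : Fin d) :
    superSwap k M r s (PiTensorProduct.tprod k v) =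
      sgn k (ε r * ε s) • PiTensorProduct.tprod k (fun i => v (Equiv.swap r s i)) := by
  rw [superSwap, LinearMap.sum_apply, Finset.sum_eq_single ε]
  · rw [LinearMap.smul_apply, LinearMap.comp_apply, tproj_of_hom hv, if_pos rfl]
    congr 1
    exact PiTensorProduct.reindex_tprod _ _
  · intro ε' _ hne
    rw [LinearMap.smul_apply, LinearMap.comp_apply, tproj_of_hom hv, if_neg hne, map_zero,
      smul_zero]
  · intro h; exact absurd (Finset.mem_univ _) h

/-- The divided power `Γ^d M = (M^{⊗d})^{𝔖_d}`: the tensors fixed by the supertwists of all pairs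
of adjacent factors (the adjacent transpositions generate `𝔖_d`). -/
def divPow (k : Type*) [CommRing k] (d : ℕ) (M : Type*) [AddCommGroup M] [Module k M]
    [Supermodule k M] : Submodule k (TPow k d M) where
  carrier := {x | ∀ r s : Fin d, s.val = r.val + 1 → superSwap k M r s x = x}
  add_mem' hx hy r s h := by rw [map_add, hx r s h, hy r s h]
  zero_mem' r s h := map_zero _
  smul_mem' c x hx r s h := by rw [map_smul, hx r s h]

theorem superSwap_mem_part (r s : Fin d) (e : ZMod 2) (x : TPow k d M)
    (hx : x ∈ part k (M := TPow k d M) e) :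
    superSwap k M r s x ∈ part k (M := TPow k d M) e := by
  induction hx using Submodule.span_induction with
  | mem x hx =>
    obtain ⟨ε, v, hv, rfl, rfl⟩ := hx
    rw [superSwap_tprod hv]
    refine Submodule.smul_mem _ _ ?_
    have := tprod_mem_part (k := k) (M := M) (ε := fun i => ε (Equiv.swap r s i))
      (v := fun i => v (Equiv.swap r s i)) (fun i => hv _)
    rwa [Equiv.sum_comp (Equiv.swap r s) ε] at this
  | zero => rw [map_zero]; exact Submodule.zero_mem _
  | add x y _ _ hx hy => rw [map_add]; exact Submodule.add_mem _ hx hy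
  | smul c x _ hx => rw [map_smul]; exact Submodule.smul_mem _ _ hx

/-- `Γ^d M` is a subsupermodule of `M^{⊗d}`. -/
instance divPowSupermodule : Supermodule k (divPow k d M) :=
  subSupermodule (divPow k d M) fun i m hm r s h => by
    have := proj_map (k := k) 0 (fun x => superSwap k M r s x) (map_add _)
      (fun j x hx => by rw [add_zero]; exact superSwap_mem_part r s j x hx) i m
    rw [add_zero] at this
    rw [← this, hm r s h]

/-- The exponent of the sign that arises when `(x₁ ⊗ ⋯ ⊗ x_d) ⊗ (y₁ ⊗ ⋯ ⊗ y_d)` is rearranged to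
`(x₁ ⊗ y₁) ⊗ ⋯ ⊗ (x_d ⊗ y_d)`: every `y_j` moves past all `x_i` with `i > j`. -/
def koszul {d : ℕ} (ε δ : Fin d → ZMod 2) : ZMod 2 :=
  ∑ i, ∑ j, if j < i then ε i * δ j else 0

/-- The map `M^{⊗d} × N^{⊗d} → (M ⊗ N)^{⊗d} → L^{⊗d}` induced by a bilinear map
`c : M × N → L`, with the rule of signs. -/
def star (d : ℕ) (c : M →ₗ[k] N →ₗ[k] L) : TPow k d M →ₗ[k] TPow k d N →ₗ[k] TPow k d L :=
  ∑ ε : Fin d → ZMod 2, ∑ δ : Fin d → ZMod 2,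
    sgn k (koszul ε δ) • (PiTensorProduct.map₂ fun _ => c).compl₁₂ (tproj k ε) (tproj k δ)

theorem star_tprod (c : M →ₗ[k] N →ₗ[k] L) {ε δ : Fin d → ZMod 2} {x : Fin d → M}
    {y : Fin d → N} (hx : ∀ i, x i ∈ part k (M := M) (ε i))
    (hy : ∀ i, y i ∈ part k (M := N) (δ i)) :
    star d c (PiTensorProduct.tprod k x) (PiTensorProduct.tprod k y) =
      sgn k (koszul ε δ) • PiTensorProduct.tprod k fun i => c (x i) (y i) := by
  rw [star, LinearMap.sum_apply, LinearMap.sum_apply, Finset.sum_eq_single ε]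
  · rw [LinearMap.sum_apply, LinearMap.sum_apply, Finset.sum_eq_single δ]
    · rw [LinearMap.smul_apply, LinearMap.smul_apply, LinearMap.compl₁₂_apply, tproj_of_hom hx,
        tproj_of_hom hy, if_pos rfl, if_pos rfl, PiTensorProduct.map₂_tprod_tprod]
    · intro δ' _ hne
      rw [LinearMap.smul_apply, LinearMap.smul_apply, LinearMap.compl₁₂_apply, tproj_of_hom hy,
        if_neg hne, map_zero, smul_zero]
    · intro h; exact absurd (Finset.mem_univ _) h
  · intro ε' _ hne
    rw [LinearMap.sum_apply, LinearMap.sum_apply]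
    refine Finset.sum_eq_zero fun δ' _ => ?_
    rw [LinearMap.smul_apply, LinearMap.smul_apply, LinearMap.compl₁₂_apply, tproj_of_hom hx,
      if_neg hne, map_zero, LinearMap.zero_apply, smul_zero]
  · intro h; exact absurd (Finset.mem_univ _) h

/-- `c` is even. -/
def EvenBilin (c : M →ₗ[k] N →ₗ[k] L) : Prop :=
  ∀ (i j : ZMod 2) (x : M) (y : N), x ∈ part k (M := M) i → y ∈ part k (M := N) j →
    c x y ∈ part k (M := L) (i + j)

theorem koszul_add_left (ε ε' δ : Fin d → ZMod 2) :
    koszul (fun i => ε i + ε' i) δ = koszul ε δ + koszul ε' δ := by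
  simp only [koszul, ← Finset.sum_add_distrib]
  refine Finset.sum_congr rfl fun i _ => Finset.sum_congr rfl fun j _ => ?_
  split_ifs <;> ring

theorem koszul_add_right (ε δ δ' : Fin d → ZMod 2) :
    koszul ε (fun i => δ i + δ' i) = koszul ε δ + koszul ε δ' := by
  simp only [koszul, ← Finset.sum_add_distrib]
  refine Finset.sum_congr rfl fun i _ => Finset.sum_congr rfl fun j _ => ?_
  split_ifs <;> ring

theorem koszul_swap (ε δ : Fin d → ZMod 2) {r s : Fin d} (h : s.val = r.val + 1) :
    koszul (fun i => ε (Equiv.swap r s i)) (fun i => δ (Equiv.swap r s i)) =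
      koszul ε δ + (ε r * δ s + ε s * δ r) := by
  have hrs : r ≠ s := by intro h'; subst h'; omega
  have key : ∀ a b : Fin d,
      (if Equiv.swap r s b < Equiv.swap r s a then ε a * δ b else 0) =
        (if b < a then ε a * δ b else 0) + ((if a = r then if b = s then ε a * δ b else 0 else 0) +
          (if a = s then if b = r then ε a * δ b else 0 else 0)) := by
    intro a b
    by_cases h1 : a = r ∧ b = s
    · obtain ⟨rfl, rfl⟩ := h1
      have e1 : a < b := by rw [Fin.lt_def]; omega
      simp [hrs, e1, e1.not_gt]
    · by_cases h2 : a = s ∧ b = r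
      · obtain ⟨rfl, rfl⟩ := h2
        have e1 : b < a := by rw [Fin.lt_def]; omega
        simp [hrs.symm, e1, e1.not_gt, zmod2_add_self]
      · have e1 : (if a = r then if b = s then ε a * δ b else 0 else 0) = 0 := by
          split_ifs with p q
          · exact absurd ⟨p, q⟩ h1
          · rfl
          · rfl
        have e2 : (if a = s then if b = r then ε a * δ b else 0 else 0) = 0 := by
          split_ifs with p q
          · exact absurd ⟨p, q⟩ h2
          · rfl
          · rfl
        rw [e1, e2, add_zero, add_zero]
        congr 1
        rw [Equiv.swap_apply_def, Equiv.swap_apply_def, eq_iff_iff]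
        simp only [Fin.ext_iff, not_and] at h1 h2 hrs
        split_ifs with p q p' q' p' q' <;> simp only [Fin.ext_iff, Fin.lt_def] at * <;> omega
  calc koszul (fun i => ε (Equiv.swap r s i)) (fun i => δ (Equiv.swap r s i))
      = ∑ a, ∑ b, if Equiv.swap r s b < Equiv.swap r s a then ε a * δ b else 0 := by
        rw [koszul, ← Equiv.sum_comp (Equiv.swap r s)]
        refine Finset.sum_congr rfl fun a _ => ?_
        rw [← Equiv.sum_comp (Equiv.swap r s)]
        simp
    _ = _ := by
        simp only [key, Finset.sum_add_distrib]
        simp [koszul]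

theorem sum_swap_lemma (ε δ : Fin d → ZMod 2) {r s : Fin d} (h : s.val = r.val + 1) :
    koszul ε δ + (ε r + δ r) * (ε s + δ s) =
      ε r * ε s + δ r * δ s +
        koszul (fun i => ε (Equiv.swap r s i)) (fun i => δ (Equiv.swap r s i)) := by
  rw [koszul_swap ε δ h]; ring

/-- The multiplication of tensor powers commutes with the supertwists. -/
theorem superSwap_star {c : M →ₗ[k] N →ₗ[k] L} (hc : EvenBilin c) {r s : Fin d}
    (h : s.val = r.val + 1) (x : TPow k d M) (y : TPow k d N) :
    superSwap k L r s (star d c x y) = star d c (superSwap k M r s x) (superSwap k N r s y) := by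
  refine tpow_induction (P := fun x => superSwap k L r s (star d c x y) =
    star d c (superSwap k M r s x) (superSwap k N r s y)) x ?_ ?_ ?_
  · intro x x' hx hx'
    simp only [map_add, LinearMap.add_apply, hx, hx']
  · intro a x hx
    simp only [map_smul, LinearMap.smul_apply, hx]
  intro ε v hv
  refine tpow_induction (P := fun y => superSwap k L r s (star d c (PiTensorProduct.tprod k v) y) =
    star d c (superSwap k M r s (PiTensorProduct.tprod k v)) (superSwap k N r s y)) y ?_ ?_ ?_
  · intro x x' hx hx'
    simp only [map_add, hx, hx']
  · intro a x hx
    simp only [map_smul, hx]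
  intro δ w hw
  rw [star_tprod c hv hw, map_smul, superSwap_tprod (fun i => hc _ _ _ _ (hv i) (hw i)),
    superSwap_tprod hv, superSwap_tprod hw, map_smul, map_smul, LinearMap.smul_apply,
    star_tprod c (fun i => hv (Equiv.swap r s i)) (fun i => hw (Equiv.swap r s i)), smul_smul,
    smul_smul, smul_smul, ← sgn_add, ← sgn_add, ← sgn_add]
  congr 2
  rw [sum_swap_lemma ε δ h]
  ring

theorem star_mem_divPow {c : M →ₗ[k] N →ₗ[k] L} (hc : EvenBilin c) {x : TPow k d M}
    {y : TPow k d N} (hx : x ∈ divPow k d M) (hy : y ∈ divPow k d N) :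
    star d c x y ∈ divPow k d L := by
  intro r s h
  rw [superSwap_star hc h, hx r s h, hy r s h]

theorem star_mem_part {c : M →ₗ[k] N →ₗ[k] L} (hc : EvenBilin c) {i j : ZMod 2} {x : TPow k d M}
    {y : TPow k d N} (hx : x ∈ part k (M := TPow k d M) i) (hy : y ∈ part k (M := TPow k d N) j) :
    star d c x y ∈ part k (M := TPow k d L) (i + j) := by
  induction hx using Submodule.span_induction with
  | zero => rw [map_zero, LinearMap.zero_apply]; exact Submodule.zero_mem _
  | add x y _ _ hx hy => rw [map_add, LinearMap.add_apply]; exact Submodule.add_mem _ hx hy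
  | smul a x _ hx => rw [map_smul, LinearMap.smul_apply]; exact Submodule.smul_mem _ _ hx
  | mem x hx =>
    obtain ⟨ε, v, hv, rfl, rfl⟩ := hx
    induction hy using Submodule.span_induction with
    | zero => rw [map_zero]; exact Submodule.zero_mem _
    | add x y _ _ hx hy => rw [map_add]; exact Submodule.add_mem _ hx hy
    | smul a x _ hx => rw [map_smul]; exact Submodule.smul_mem _ _ hx
    | mem y hy =>
      obtain ⟨δ, w, hw, rfl, rfl⟩ := hy
      rw [star_tprod c hv hw, ← Finset.sum_add_distrib]
      exact Submodule.smul_mem _ _ (tprod_mem_part fun i => hc _ _ _ _ (hv i) (hw i))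

theorem star_assoc {P Q S : Type*} [AddCommGroup P] [Module k P] [Supermodule k P]
    [AddCommGroup Q] [Module k Q] [Supermodule k Q] [AddCommGroup S] [Module k S]
    [Supermodule k S]
    {c₁ : M →ₗ[k] N →ₗ[k] P} {c₂ : P →ₗ[k] Q →ₗ[k] L} {c₃ : N →ₗ[k] Q →ₗ[k] S}
    {c₄ : M →ₗ[k] S →ₗ[k] L} (h₁ : EvenBilin c₁) (h₃ : EvenBilin c₃)
    (h : ∀ m n q, c₂ (c₁ m n) q = c₄ m (c₃ n q))
    (x : TPow k d M) (y : TPow k d N) (z : TPow k d Q) :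
    star d c₂ (star d c₁ x y) z = star d c₄ x (star d c₃ y z) := by
  refine tpow_induction (P := fun x => star d c₂ (star d c₁ x y) z =
    star d c₄ x (star d c₃ y z)) x ?_ ?_ ?_
  · intro x x' hx hx'
    simp only [map_add, LinearMap.add_apply, hx, hx']
  · intro a x hx
    simp only [map_smul, LinearMap.smul_apply, hx]
  intro ε u hu
  refine tpow_induction (P := fun y => star d c₂ (star d c₁ (PiTensorProduct.tprod k u) y) z =
    star d c₄ (PiTensorProduct.tprod k u) (star d c₃ y z)) y ?_ ?_ ?_
  · intro x x' hx hx'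
    simp only [map_add, LinearMap.add_apply, hx, hx']
  · intro a x hx
    simp only [map_smul, LinearMap.smul_apply, hx]
  intro δ v hv
  refine tpow_induction (P := fun z => star d c₂ (star d c₁ (PiTensorProduct.tprod k u)
    (PiTensorProduct.tprod k v)) z =
    star d c₄ (PiTensorProduct.tprod k u) (star d c₃ (PiTensorProduct.tprod k v) z)) z ?_ ?_ ?_
  · intro x x' hx hx'
    simp only [map_add, hx, hx']
  · intro a x hx
    simp only [map_smul, hx]
  intro ζ w hw
  rw [star_tprod c₁ hu hv, star_tprod c₃ hv hw, map_smul, map_smul, LinearMap.smul_apply,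
    star_tprod c₂ (fun i => h₁ _ _ _ _ (hu i) (hv i)) hw,
    star_tprod c₄ hu (fun i => h₃ _ _ _ _ (hv i) (hw i)), smul_smul, smul_smul, ← sgn_add,
    ← sgn_add, koszul_add_left, koszul_add_right]
  congr 1
  · congr 1; ring
  · congr 1; ext i; exact h _ _ _

/-- The tensor `u ⊗ ⋯ ⊗ u`. -/
def tpure (k : Type*) [CommRing k] (d : ℕ) {M : Type*} [AddCommGroup M] [Module k M] (u : M) :
    TPow k d M := PiTensorProduct.tprod k fun _ => u

theorem tpure_mem_divPow {u : M} (hu : u ∈ part k (M := M) 0) : tpure k d u ∈ divPow k d M := by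
  intro r s _
  rw [tpure, superSwap_tprod (ε := fun _ => 0) (fun _ => hu)]
  simp

theorem tpure_mem_part {u : M} (hu : u ∈ part k (M := M) 0) :
    tpure k d u ∈ part k (M := TPow k d M) 0 := by
  have := tprod_mem_part (k := k) (ε := fun _ : Fin d => 0) (v := fun _ => u) (fun _ => hu)
  simpa [tpure] using this

theorem star_tpure_left {c : M →ₗ[k] N →ₗ[k] N} {u : M} (hu : u ∈ part k (M := M) 0)
    (h : ∀ n, c u n = n) (y : TPow k d N) : star d c (tpure k d u) y = y := by
  refine tpow_induction (P := fun y => star d c (tpure k d u) y = y) y ?_ ?_ ?_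
  · intro x x' hx hx'; rw [map_add, hx, hx']
  · intro a x hx; rw [map_smul, hx]
  intro δ w hw
  rw [tpure, star_tprod c (ε := fun _ => 0) (fun _ => hu) hw]
  simp [koszul, h]

theorem star_tpure_right {c : M →ₗ[k] N →ₗ[k] M} {u : N} (hu : u ∈ part k (M := N) 0)
    (h : ∀ m, c m u = m) (x : TPow k d M) : star d c x (tpure k d u) = x := by
  refine tpow_induction (P := fun x => star d c x (tpure k d u) = x) x ?_ ?_ ?_
  · intro x x' hx hx'; rw [map_add, LinearMap.add_apply, hx, hx']
  · intro a x hx; rw [map_smul, LinearMap.smul_apply, hx]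
  intro δ w hw
  rw [tpure, star_tprod c hw (δ := fun _ => 0) (fun _ => hu)]
  simp [koszul, h]

/-- The map `Γ^d M × Γ^d N → Γ^d (M ⊗ N) → Γ^d L` induced by an even bilinear map. -/
def gammaMul (d : ℕ) (c : M →ₗ[k] N →ₗ[k] L) (hc : EvenBilin c) (x : divPow k d M)
    (y : divPow k d N) : divPow k d L :=
  ⟨star d c x.1 y.1, star_mem_divPow hc x.2 y.2⟩

end TPow

/-! ### Superalgebras -/

/-- A superalgebra: a `k`-algebra with a supermodule structure for which multiplication is even. -/
class Superalgebra (k : Type*) [CommRing k] (A : Type*) [Ring A] [Algebra k A] extends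
    Supermodule k A where
  one_mem : (1 : A) ∈ Supermodule.part (k := k) (M := A) 0
  mul_mem : ∀ (i j : ZMod 2) (a b : A), a ∈ Supermodule.part (k := k) (M := A) i →
    b ∈ Supermodule.part (k := k) (M := A) j → a * b ∈ Supermodule.part (k := k) (M := A) (i + j)

section GammaAlgebra

variable (k : Type*) [CommRing k] (d : ℕ) (B : Type*) [Ring B] [Algebra k B] [Superalgebra k B]

theorem evenBilin_mul : EvenBilin (LinearMap.mul k B) :=
  fun i j x y hx hy => Superalgebra.mul_mem i j x y hx hy

/-- The ring structure on `Γ^d B` for a superalgebra `B`: the product is induced by that of `B`,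
with the rule of signs. -/
instance gammaRing : Ring (divPow k d B) :=
  { (inferInstance : AddCommGroup (divPow k d B)) with
    mul := fun x y => gammaMul d (LinearMap.mul k B) (evenBilin_mul k B) x y
    one := ⟨tpure k d 1, tpure_mem_divPow Superalgebra.one_mem⟩
    left_distrib := fun x y z => Subtype.ext (map_add (star d (LinearMap.mul k B) x.1) y.1 z.1)
    right_distrib := fun x y z => Subtype.ext
      (by change star d (LinearMap.mul k B) (x.1 + y.1) z.1 = _
          rw [map_add]; rfl)
    zero_mul := fun x => Subtype.ext
      (by change star d (LinearMap.mul k B) 0 x.1 = 0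
          rw [map_zero]; rfl)
    mul_zero := fun x => Subtype.ext (map_zero (star d (LinearMap.mul k B) x.1))
    mul_assoc := fun x y z => Subtype.ext
      (star_assoc (evenBilin_mul k B) (evenBilin_mul k B) (fun a b c => mul_assoc a b c) _ _ _)
    one_mul := fun x => Subtype.ext
      (star_tpure_left Superalgebra.one_mem (fun b => one_mul b) x.1)
    mul_one := fun x => Subtype.ext
      (star_tpure_right Superalgebra.one_mem (fun b => mul_one b) x.1) }

instance gammaAlgebra : Algebra k (divPow k d B) :=
  Algebra.ofModule
    (fun c x y => Subtype.ext
      (by change star d (LinearMap.mul k B) (c • x.1) y.1 = _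
          rw [map_smul]; rfl))
    (fun c x y => Subtype.ext (map_smul (star d (LinearMap.mul k B) x.1) c y.1))

instance gammaSuperalgebra : Superalgebra k (divPow k d B) where
  toSupermodule := divPowSupermodule
  one_mem := tpure_mem_part (k := k) (d := d) (Superalgebra.one_mem (k := k) (A := B))
  mul_mem _ _ _ _ hx hy := star_mem_part (evenBilin_mul k B) hx hy

end GammaAlgebra

/-! ### Enriched categories -/

/-- A category enriched in `k`-supermodules: a `k`-linear category whose morphism modules are
supermodules and whose composition is even. -/
class SuperCategory (k : Type w) [CommRing k] (C : Type u) [Category.{v} C] [Preadditive C]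
    [Linear k C] where
  homSuper : ∀ X Y : C, Supermodule k (X ⟶ Y)
  id_mem : ∀ X : C, 𝟙 X ∈ (homSuper X X).part 0
  comp_mem : ∀ {X Y Z : C} (i j : ZMod 2) (f : X ⟶ Y) (g : Y ⟶ Z),
    f ∈ (homSuper X Y).part i → g ∈ (homSuper Y Z).part j → f ≫ g ∈ (homSuper X Z).part (i + j)

attribute [reducible, instance] SuperCategory.homSuper

/-- The category `Γ^d C`; it has the same objects as `C`. -/
structure Gamma (k : Type w) (d : ℕ) (C : Type u) where
  of : C

section Gamma

variable (k : Type v) [CommRing k] (d : ℕ) {C : Type u} [Category.{v} C] [Preadditive C]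
  [Linear k C] [SuperCategory k C]

/-- Composition `Hom(Y, Z) × Hom(X, Y) → Hom(X, Z)`, `(g, f) ↦ g ∘ f`. -/
def compBilin (X Y Z : C) : (Y ⟶ Z) →ₗ[k] (X ⟶ Y) →ₗ[k] (X ⟶ Z) :=
  LinearMap.mk₂ k (fun g f => f ≫ g) (fun _ _ _ => Preadditive.comp_add _ _ _ _ _ _)
    (fun _ _ _ => Linear.comp_smul _ _ _ _ _ _) (fun _ _ _ => Preadditive.add_comp _ _ _ _ _ _)
    (fun _ _ _ => Linear.smul_comp _ _ _ _ _ _)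

theorem evenBilin_comp (X Y Z : C) : EvenBilin (compBilin k X Y Z) := fun i j g f hg hf => by
  rw [add_comm]; exact SuperCategory.comp_mem j i f g hf hg

/-- Morphisms of `Γ^d C` are the elements of `Γ^d Hom_C(X, Y)`; the composite of `f` and `g` is the
image of `g ⊗ f` under `Γ^d Hom(Y, Z) ⊗ Γ^d Hom(X, Y) → Γ^d (Hom(Y, Z) ⊗ Hom(X, Y)) →
Γ^d Hom(X, Z)`. -/
instance gammaCategory : Category.{v} (Gamma k d C) where
  Hom X Y := divPow k d (X.of ⟶ Y.of)
  id X := ⟨tpure k d (𝟙 X.of), tpure_mem_divPow (SuperCategory.id_mem X.of)⟩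
  comp f g := gammaMul d (compBilin k _ _ _) (evenBilin_comp k _ _ _) g f
  id_comp f := Subtype.ext
    (star_tpure_right (SuperCategory.id_mem _) (fun f => Category.id_comp f) f.1)
  comp_id f := Subtype.ext
    (star_tpure_left (SuperCategory.id_mem _) (fun f => Category.comp_id f) f.1)
  assoc f g h := Subtype.ext
    (star_assoc (evenBilin_comp k _ _ _) (evenBilin_comp k _ _ _)
      (fun h g f => (Category.assoc f g h).symm) h.1 g.1 f.1).symm

instance gammaPreadditive : Preadditive (Gamma k d C) where
  homGroup X Y := inferInstanceAs (AddCommGroup (divPow k d (X.of ⟶ Y.of)))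
  add_comp X Y Z f f' g := Subtype.ext (map_add (star d (compBilin k _ _ _) g.1) f.1 f'.1)
  comp_add X Y Z f g g' := Subtype.ext
    (by change star d (compBilin k _ _ _) (g.1 + g'.1) f.1 = _
        rw [map_add]; rfl)

instance gammaLinear : Linear k (Gamma k d C) where
  homModule X Y := inferInstanceAs (Module k (divPow k d (X.of ⟶ Y.of)))
  smul_comp X Y Z c f g := Subtype.ext (map_smul (star d (compBilin k _ _ _) g.1) c f.1)
  comp_smul X Y Z f c g := Subtype.ext
    (by change star d (compBilin k _ _ _) (c • g.1) f.1 = _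
        rw [map_smul]; rfl)

instance gammaSuperCategory : SuperCategory k (Gamma k d C) where
  homSuper X Y := inferInstanceAs (Supermodule k (divPow k d (X.of ⟶ Y.of)))
  id_mem X := tpure_mem_part (SuperCategory.id_mem X.of)
  comp_mem i j f g hf hg := by
    rw [add_comm]; exact star_mem_part (evenBilin_comp k _ _ _) hg hf

end Gamma

/-- An even `k`-linear functor. -/
structure SuperFunctor (k : Type w) [CommRing k] (C : Type*) [Category* C] [Preadditive C]
    [Linear k C] [SuperCategory k C] (D : Type*) [Category* D] [Preadditive D] [Linear k D]
    [SuperCategory k D] extends C ⥤ D where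
  map_add : ∀ {X Y : C} (f g : X ⟶ Y), map (f + g) = map f + map g
  map_smul : ∀ {X Y : C} (c : k) (f : X ⟶ Y), map (c • f) = c • map f
  map_mem : ∀ {X Y : C} (i : ZMod 2) (f : X ⟶ Y), f ∈ part k (M := X ⟶ Y) i →
    map f ∈ part k (M := obj X ⟶ obj Y) i

/-- The functor is an equivalence of categories, and every object of `D` is isomorphic to an object
of the image through an even isomorphism. -/
structure SuperFunctor.IsSuperEquivalence {k : Type w} [CommRing k] {C : Type*} [Category* C]
    [Preadditive C] [Linear k C] [SuperCategory k C] {D : Type*} [Category* D] [Preadditive D]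
    [Linear k D] [SuperCategory k D] (F : SuperFunctor k C D) : Prop where
  isEquivalence : F.toFunctor.IsEquivalence
  even_essSurj : ∀ Y : D, ∃ (X : C) (e : F.obj X ≅ Y), e.hom ∈ part k (M := F.obj X ⟶ Y) 0

section Fun

variable {k : Type w} [CommRing k] {C : Type*} [Category* C] [Preadditive C]
  [Linear k C] [SuperCategory k C] {D : Type*} [Category* D] [Preadditive D] [Linear k D]
  [SuperCategory k D]

theorem proj_comp_right {X Y Z : D} (i j : ZMod 2) (f : X ⟶ Y) {g : Y ⟶ Z}
    (hg : g ∈ part k (M := Y ⟶ Z) i) : proj k (j + i) (f ≫ g) = proj k j f ≫ g :=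
  proj_map i (fun f => f ≫ g) (fun _ _ => Preadditive.add_comp _ _ _ _ _ _)
    (fun j f hf => SuperCategory.comp_mem j i f g hf hg) j f

theorem comp_eq_sum {X Y Z : D} (f : X ⟶ Y) (g : Y ⟶ Z) (e : ZMod 2) :
    proj k e (f ≫ g) = ∑ i : ZMod 2, proj k (e + i) f ≫ proj k i g := by
  conv_lhs => rw [← sum_proj (k := k) g, Preadditive.comp_sum, map_sum]
  refine Finset.sum_congr rfl fun i _ => ?_
  have := proj_comp_right (k := k) i (e + i) f (proj_mem i g)
  rwa [add_assoc, zmod2_add_self, add_zero] at this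

/-- The `k`-module of enriched natural transformations `F ⟶ G`: families `η` whose homogeneous
components `η_j` satisfy `G(φ) ∘ η_j(X) = (-1)^{ij} η_j(Y) ∘ F(φ)` for all `φ : X ⟶ Y` of
parity `i`. -/
def superNatTrans (F G : SuperFunctor k C D) : Submodule k (∀ X : C, F.obj X ⟶ G.obj X) where
  carrier := {η | ∀ (i j : ZMod 2) (X Y : C) (φ : X ⟶ Y), φ ∈ part k (M := X ⟶ Y) i →
    proj k j (η X) ≫ G.map φ = sgn k (i * j) • (F.map φ ≫ proj k j (η Y))}
  add_mem' hη hθ i j X Y φ hφ := by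
    simp only [Pi.add_apply, map_add, Preadditive.add_comp, Preadditive.comp_add, smul_add,
      hη i j X Y φ hφ, hθ i j X Y φ hφ]
  zero_mem' i j X Y φ hφ := by simp
  smul_mem' c η hη i j X Y φ hφ := by
    simp only [Pi.smul_apply, map_smul, Linear.smul_comp, Linear.comp_smul, hη i j X Y φ hφ]
    rw [smul_comm]

theorem proj_id {X : D} (j : ZMod 2) : proj k j (𝟙 X) = if j = 0 then 𝟙 X else 0 := by
  split_ifs with h
  · subst h; exact proj_of_mem (SuperCategory.id_mem X)
  · exact proj_of_mem_ne (SuperCategory.id_mem X) h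

theorem superNatTrans_id (F : SuperFunctor k C D) :
    (fun X => 𝟙 (F.obj X)) ∈ superNatTrans F F := by
  intro i j X Y φ hφ
  simp only [proj_id]
  split_ifs with h
  · subst h; simp
  · simp

theorem superNatTrans_comp {F G H : SuperFunctor k C D} {η : ∀ X : C, F.obj X ⟶ G.obj X}
    {θ : ∀ X : C, G.obj X ⟶ H.obj X} (hη : η ∈ superNatTrans F G) (hθ : θ ∈ superNatTrans G H) :
    (fun X => η X ≫ θ X) ∈ superNatTrans F H := by
  intro i j X Y φ hφ
  simp only [comp_eq_sum, Preadditive.sum_comp, Preadditive.comp_sum, Finset.smul_sum]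
  refine Finset.sum_congr rfl fun l _ => ?_
  rw [Category.assoc, hθ i l X Y φ hφ, Linear.comp_smul, ← Category.assoc, hη i (j + l) X Y φ hφ,
    Linear.smul_comp, Category.assoc, smul_smul, ← sgn_add]
  congr 2
  rw [mul_add, add_comm (i * j), ← add_assoc, zmod2_add_self, zero_add]

/-- The category `Fun_k(C, D)` of even `k`-linear functors and enriched natural transformations. -/
instance funCategory : Category (SuperFunctor k C D) where
  Hom F G := superNatTrans F G
  id F := ⟨_, superNatTrans_id F⟩
  comp η θ := ⟨_, superNatTrans_comp η.2 θ.2⟩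
  id_comp η := Subtype.ext (funext fun X => Category.id_comp _)
  comp_id η := Subtype.ext (funext fun X => Category.comp_id _)
  assoc η θ ζ := Subtype.ext (funext fun X => Category.assoc _ _ _)

instance funPreadditive : Preadditive (SuperFunctor k C D) where
  homGroup F G := inferInstanceAs (AddCommGroup (superNatTrans F G))
  add_comp _ _ _ _ _ _ := Subtype.ext (funext fun X => Preadditive.add_comp _ _ _ _ _ _)
  comp_add _ _ _ _ _ _ := Subtype.ext (funext fun X => Preadditive.comp_add _ _ _ _ _ _)

instance funLinear : Linear k (SuperFunctor k C D) where
  homModule F G := inferInstanceAs (Module k (superNatTrans F G))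
  smul_comp _ _ _ _ _ _ := Subtype.ext (funext fun X => Linear.smul_comp _ _ _ _ _ _)
  comp_smul _ _ _ _ _ _ := Subtype.ext (funext fun X => Linear.comp_smul _ _ _ _ _ _)

instance funSuperCategory : SuperCategory k (SuperFunctor k C D) where
  homSuper F G := subSupermodule (superNatTrans F G) fun e η hη i j X Y φ hφ => by
    rw [proj_pi, proj_pi, proj_proj, proj_proj]
    split_ifs with h
    · subst h; exact hη i _ X Y φ hφ
    · simp
  id_mem F := fun X _ => SuperCategory.id_mem (k := k) (F.obj X)
  comp_mem i j η θ hη hθ := fun X _ =>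
    SuperCategory.comp_mem i j (η.1 X) (θ.1 X) (hη X trivial) (hθ X trivial)

end Fun

/-- The full subcategory of `C` on the objects satisfying `Q`. -/
structure FullSub {C : Type u} (Q : C → Prop) where
  obj : C
  property : Q obj

section FullSub

variable {k : Type w} [CommRing k] {C : Type u} [Category.{v} C] [Preadditive C]
  [Linear k C] [SuperCategory k C] (Q : C → Prop)

instance fullSubCategory : Category.{v} (FullSub Q) where
  Hom X Y := X.obj ⟶ Y.obj
  id X := 𝟙 X.obj
  comp f g := (f ≫ g : _ ⟶ _)
  id_comp {X Y} f := Category.id_comp (X := X.obj) (Y := Y.obj) f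
  comp_id {X Y} f := Category.comp_id (X := X.obj) (Y := Y.obj) f
  assoc {W X Y Z} f g h :=
    Category.assoc (W := W.obj) (X := X.obj) (Y := Y.obj) (Z := Z.obj) f g h

instance fullSubPreadditive : Preadditive (FullSub Q) where
  homGroup X Y := inferInstanceAs (AddCommGroup (X.obj ⟶ Y.obj))
  add_comp X Y Z f g h := Preadditive.add_comp (C := C) X.obj Y.obj Z.obj f g h
  comp_add X Y Z f g h := Preadditive.comp_add (C := C) X.obj Y.obj Z.obj f g h

instance fullSubLinear : Linear k (FullSub Q) where
  homModule X Y := inferInstanceAs (Module k (X.obj ⟶ Y.obj))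
  smul_comp X Y Z c f g := Linear.smul_comp (C := C) X.obj Y.obj Z.obj c f g
  comp_smul X Y Z f c g := Linear.comp_smul (C := C) X.obj Y.obj Z.obj f c g

instance fullSubSuperCategory : SuperCategory k (FullSub Q) where
  homSuper X Y := inferInstanceAs (Supermodule k (X.obj ⟶ Y.obj))
  id_mem X := SuperCategory.id_mem (k := k) X.obj
  comp_mem i j f g hf hg := SuperCategory.comp_mem (k := k) (C := C) i j f g hf hg

end FullSub

/-! ### The category `𝒱_k` -/

/-- A finitely generated projective `k`-supermodule. -/
structure SVect (k : Type u) [CommRing k] where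
  carrier : Type u
  [addCommGroup : AddCommGroup carrier]
  [module : Module k carrier]
  [super : Supermodule k carrier]
  [finite : Module.Finite k carrier]
  [projective : Module.Projective k carrier]

attribute [instance] SVect.addCommGroup SVect.module SVect.super SVect.finite SVect.projective

section SVect

variable {k : Type u} [CommRing k]

/-- Morphisms of `𝒱_k` are all `k`-linear maps. -/
instance svectCategory : Category.{u} (SVect k) where
  Hom X Y := X.carrier →ₗ[k] Y.carrier
  id X := LinearMap.id
  comp f g := g.comp f

/-- The linear map underlying a morphism of `𝒱_k`. -/
abbrev svHom {X Y : SVect k} (f : X ⟶ Y) : X.carrier →ₗ[k] Y.carrier := f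

instance svectPreadditive : Preadditive (SVect k) where
  homGroup X Y := inferInstanceAs (AddCommGroup (X.carrier →ₗ[k] Y.carrier))
  add_comp _ _ _ f g h := LinearMap.comp_add f g h
  comp_add _ _ _ f g h := rfl

instance svectLinear : Linear k (SVect k) where
  homModule X Y := inferInstanceAs (Module k (X.carrier →ₗ[k] Y.carrier))
  smul_comp X Y Z c f g := LinearMap.ext fun x =>
    LinearMap.map_smul (show Y.carrier →ₗ[k] Z.carrier from g) c
      ((show X.carrier →ₗ[k] Y.carrier from f) x)
  comp_smul _ _ _ f c g := rfl

instance svectSuperCategory : SuperCategory k (SVect k) where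
  homSuper X Y := inferInstanceAs (Supermodule k (X.carrier →ₗ[k] Y.carrier))
  id_mem X := id_mem_part_hom (k := k) (R := k) (M := X.carrier)
  comp_mem i j f g hf hg := comp_mem_part_hom (k := k) (R := k) hf hg

end SVect

/-- `rep C`: the even `k`-linear functors from `C` to `𝒱_k`. -/
abbrev Rep (k : Type u) [CommRing k] (C : Type*) [Category* C] [Preadditive C] [Linear k C]
    [SuperCategory k C] : Type _ := SuperFunctor k C (SVect k)

/-! ### Left supermodules -/

/-- A left supermodule over the superalgebra `E` that lies in `𝒱_k`, i.e. that is finitely generated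
and projective over `k`. -/
structure LSMod (k E : Type u) [CommRing k] [Ring E] [Algebra k E] [Superalgebra k E] where
  carrier : Type u
  [addCommGroup : AddCommGroup carrier]
  [kmodule : Module k carrier]
  [emodule : Module E carrier]
  [tower : IsScalarTower k E carrier]
  [super : Supermodule k carrier]
  [graded : GradedAction k E carrier]
  [finite : Module.Finite k carrier]
  [projective : Module.Projective k carrier]

attribute [instance] LSMod.addCommGroup LSMod.kmodule LSMod.emodule LSMod.tower LSMod.super
  LSMod.graded LSMod.finite LSMod.projective

section LSMod

variable {k E : Type u} [CommRing k] [Ring E] [Algebra k E] [Superalgebra k E]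

/-- `Hom_E(M, N)`: the `k`-linear maps whose homogeneous components `f_j` satisfy
`f_j(a v) = (-1)^{ij} a f_j(v)` for all `a ∈ E` of parity `i`. -/
def leftHom (M N : LSMod k E) : Submodule k (M.carrier →ₗ[k] N.carrier) where
  carrier := {f | ∀ (i j : ZMod 2) (a : E) (v : M.carrier), a ∈ part k (M := E) i →
    proj k j f (a • v) = sgn k (i * j) • a • proj k j f v}
  add_mem' hf hg i j a v ha := by
    simp only [map_add, LinearMap.add_apply, hf i j a v ha, hg i j a v ha, smul_add]
  zero_mem' i j a v ha := by simp
  smul_mem' c f hf i j a v ha := by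
    simp only [map_smul, LinearMap.smul_apply, hf i j a v ha]
    rw [smul_comm c (sgn k (i * j)), smul_comm c a]

theorem leftHom_proj {M N : LSMod k E} (e : ZMod 2) (f : M.carrier →ₗ[k] N.carrier)
    (hf : f ∈ leftHom M N) : proj k e f ∈ leftHom M N := by
  intro i j a v ha
  rw [proj_proj]
  split_ifs with h
  · subst h; exact hf i _ a v ha
  · simp

/-- The underlying object of `𝒱_k`. -/
def LSMod.toSVect (M : LSMod k E) : SVect k := ⟨M.carrier⟩

theorem leftHom_id (M : LSMod k E) : LinearMap.id ∈ leftHom M M := by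
  intro i j a v ha
  have h := proj_id (k := k) (X := M.toSVect) j
  change proj k j (LinearMap.id : M.carrier →ₗ[k] M.carrier) = _ at h
  rw [h]
  split_ifs with h'
  · subst h'
    change a • v = sgn k (i * 0) • a • v
    simp
  · change (0 : M.carrier) = sgn k (i * j) • a • (0 : M.carrier)
    simp

theorem leftHom_comp {M N P : LSMod k E} {f : M.carrier →ₗ[k] N.carrier}
    {g : N.carrier →ₗ[k] P.carrier} (hf : f ∈ leftHom M N) (hg : g ∈ leftHom N P) :
    g.comp f ∈ leftHom M P := by
  intro i j a v ha
  have h := comp_eq_sum (k := k) (X := M.toSVect) (Y := N.toSVect) (Z := P.toSVect) f g j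
  have h' : proj k j (g.comp f) = ∑ l : ZMod 2, (proj k l g).comp (proj k (j + l) f) := h
  rw [h', LinearMap.sum_apply, LinearMap.sum_apply, Finset.smul_sum, Finset.smul_sum]
  refine Finset.sum_congr rfl fun l _ => ?_
  rw [LinearMap.comp_apply, LinearMap.comp_apply, hf i (j + l) a v ha, map_smul,
    hg i l a _ ha, smul_smul, ← sgn_add]
  congr 2
  rw [mul_add, add_assoc, zmod2_add_self, add_zero]

/-- The category of left `E`-supermodules that are finitely generated projective over `k`; morphisms
need not be homogeneous. -/
instance lsmodCategory : Category.{u} (LSMod k E) where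
  Hom M N := leftHom M N
  id M := ⟨LinearMap.id, leftHom_id M⟩
  comp f g := ⟨g.1.comp f.1, leftHom_comp f.2 g.2⟩

instance lsmodPreadditive : Preadditive (LSMod k E) where
  homGroup M N := inferInstanceAs (AddCommGroup (leftHom M N))
  add_comp _ _ _ f g h := Subtype.ext (LinearMap.comp_add f.1 g.1 h.1)
  comp_add _ _ _ f g h := rfl

instance lsmodLinear : Linear k (LSMod k E) where
  homModule M N := inferInstanceAs (Module k (leftHom M N))
  smul_comp _ _ _ c f g := Subtype.ext (LinearMap.ext fun x => LinearMap.map_smul g.1 c (f.1 x))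
  comp_smul _ _ _ f c g := rfl

instance lsmodSuperCategory : SuperCategory k (LSMod k E) where
  homSuper M N := show Supermodule k (leftHom M N) from
    subSupermodule (leftHom M N) leftHom_proj
  id_mem M := id_mem_part_hom (k := k) (R := k) (M := M.carrier)
  comp_mem i j f g hf hg := comp_mem_part_hom (k := k) (R := k) (f := f.1) (g := g.1) hf hg

end LSMod

/-! ### Right supermodules -/

/-- The grading of the opposite ring; right `A`-modules are encoded as modules over `Aᵐᵒᵖ`. -/
instance opSupermodule (k A : Type*) [CommRing k] [Ring A] [Algebra k A] [Supermodule k A] :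
    Supermodule k Aᵐᵒᵖ where
  part i := (part k i : Submodule k A).comap (MulOpposite.opLinearEquiv k).symm.toLinearMap
  isCompl := isCompl_of_proj
    (fun i => (part k i : Submodule k A).comap (MulOpposite.opLinearEquiv k).symm.toLinearMap)
    (fun i a => MulOpposite.op (proj k i a.unop))
    (fun i a => proj_mem i a.unop)
    (fun i a ha => MulOpposite.unop_injective (proj_of_mem ha))
    (fun i j a ha hij => MulOpposite.unop_injective (proj_of_mem_ne (M := A) ha hij))
    (fun a => MulOpposite.unop_injective (proj_zero_add_proj_one a.unop))

/-- A right `A`-supermodule. -/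
structure RSMod (k A : Type u) [CommRing k] [Ring A] [Algebra k A] [Superalgebra k A] where
  carrier : Type u
  [addCommGroup : AddCommGroup carrier]
  [kmodule : Module k carrier]
  [amodule : Module Aᵐᵒᵖ carrier]
  [tower : IsScalarTower k Aᵐᵒᵖ carrier]
  [super : Supermodule k carrier]
  [graded : GradedAction k Aᵐᵒᵖ carrier]

attribute [instance] RSMod.addCommGroup RSMod.kmodule RSMod.amodule RSMod.tower RSMod.super
  RSMod.graded

section RSMod

variable {k A : Type u} [CommRing k] [Ring A] [Algebra k A] [Superalgebra k A]

/-- Morphisms of right `A`-supermodules are all right `A`-linear maps. -/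
instance rsmodCategory : Category.{u} (RSMod k A) where
  Hom X Y := X.carrier →ₗ[Aᵐᵒᵖ] Y.carrier
  id X := LinearMap.id
  comp f g := g.comp f

instance rsmodPreadditive : Preadditive (RSMod k A) where
  homGroup X Y := inferInstanceAs (AddCommGroup (X.carrier →ₗ[Aᵐᵒᵖ] Y.carrier))
  add_comp _ _ _ f g h := LinearMap.comp_add f g h
  comp_add _ _ _ f g h := rfl

instance rsmodLinear : Linear k (RSMod k A) where
  homModule X Y := inferInstanceAs (Module k (X.carrier →ₗ[Aᵐᵒᵖ] Y.carrier))
  smul_comp X Y Z c f g := by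
    refine LinearMap.ext fun x => ?_
    exact LinearMap.map_smul_of_tower (show Y.carrier →ₗ[Aᵐᵒᵖ] Z.carrier from g) c
      ((show X.carrier →ₗ[Aᵐᵒᵖ] Y.carrier from f) x)
  comp_smul _ _ _ f c g := rfl

instance rsmodSuperCategory : SuperCategory k (RSMod k A) where
  homSuper X Y := inferInstanceAs (Supermodule k (X.carrier →ₗ[Aᵐᵒᵖ] Y.carrier))
  id_mem X := id_mem_part_hom (k := k) (R := Aᵐᵒᵖ) (M := X.carrier)
  comp_mem i j f g hf hg := comp_mem_part_hom (k := k) (R := Aᵐᵒᵖ) hf hg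

/-- `M` is a projective object of the category of right `A`-supermodules and even maps: even maps
from `M` lift through even surjections. -/
def RSMod.IsProjective (M : RSMod k A) : Prop :=
  ∀ (N N' : RSMod k A) (g : N.carrier →ₗ[Aᵐᵒᵖ] N'.carrier) (f : M.carrier →ₗ[Aᵐᵒᵖ] N'.carrier),
    g ∈ part k (M := N.carrier →ₗ[Aᵐᵒᵖ] N'.carrier) 0 →
    f ∈ part k (M := M.carrier →ₗ[Aᵐᵒᵖ] N'.carrier) 0 → Function.Surjective g →
    ∃ h : M.carrier →ₗ[Aᵐᵒᵖ] N.carrier,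
      h ∈ part k (M := M.carrier →ₗ[Aᵐᵒᵖ] N.carrier) 0 ∧ g.comp h = f

/-- The endomorphism superalgebra `End_A(M)` of a right `A`-supermodule. -/
instance endSuperalgebra (M : RSMod k A) : Superalgebra k (Module.End Aᵐᵒᵖ M.carrier) where
  toSupermodule := homSupermodule (k := k) (R := Aᵐᵒᵖ) (M := M.carrier) (N := M.carrier)
  one_mem := id_mem_part_hom (k := k) (R := Aᵐᵒᵖ) (M := M.carrier)
  mul_mem i j f g hf hg := by
    rw [add_comm]
    exact comp_mem_part_hom (k := k) (R := Aᵐᵒᵖ) (M := M.carrier) (N := M.carrier)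
      (P := M.carrier) hg hf

end RSMod

/-! ### Free supermodules -/

/-- The underlying module of the free right `A`-supermodule on basis vectors `v_i` (`i ∈ ι`) of
parity `π i`. -/
def FreeCarrier (A : Type u) {ι : Type} (π : ι → ZMod 2) : Type u := ι → A

section Free

variable (k A : Type u) [CommRing k] [Ring A] [Algebra k A] [Superalgebra k A]
variable {ι : Type} (π : ι → ZMod 2)

instance : AddCommGroup (FreeCarrier A π) := inferInstanceAs (AddCommGroup (ι → A))
instance : Module k (FreeCarrier A π) := inferInstanceAs (Module k (ι → A))
instance : Module Aᵐᵒᵖ (FreeCarrier A π) := inferInstanceAs (Module Aᵐᵒᵖ (ι → A))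
instance : IsScalarTower k Aᵐᵒᵖ (FreeCarrier A π) :=
  inferInstanceAs (IsScalarTower k Aᵐᵒᵖ (ι → A))

/-- The vectors of parity `e` in the free supermodule: the coordinate at a basis vector of parity
`π i` has parity `e + π i`. -/
def freePart (e : ZMod 2) : Submodule k (FreeCarrier A π) where
  carrier := {v | ∀ i, v i ∈ part k (M := A) (e + π i)}
  add_mem' hv hw i := Submodule.add_mem _ (hv i) (hw i)
  zero_mem' i := Submodule.zero_mem _
  smul_mem' c v hv i := Submodule.smul_mem _ c (hv i)

instance freeSupermodule : Supermodule k (FreeCarrier A π) where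
  part e := freePart k A π e
  isCompl := isCompl_of_proj (freePart k A π)
    (fun e v i => proj k (e + π i) (v i))
    (fun e v i => proj_mem _ _)
    (fun e v hv => funext fun i => proj_of_mem (hv i))
    (fun e e' v hv hne => funext fun i =>
      proj_of_mem_ne (M := A) (hv i) fun h => hne (add_right_cancel h))
    (fun v => funext fun i => by
      change proj k (0 + π i) (v i) + proj k (1 + π i) (v i) = v i
      have h : (1 : ZMod 2) + 1 = 0 := by decide
      rcases zmod2_cases (π i) with h' | h' <;> rw [h']
      · simpa using proj_zero_add_proj_one (v i)
      · rw [h, zero_add, add_comm]; exact proj_zero_add_proj_one (v i))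

/-- The free right `A`-supermodule with basis vectors of parities `π`. -/
def freeMod : RSMod k A where
  carrier := FreeCarrier A π
  graded := ⟨fun i j r v hr hv l => by
    have := Superalgebra.mul_mem (k := k) _ _ _ _ (hv l) hr
    have e : j + π l + i = i + j + π l := by ring
    rw [e] at this
    exact this⟩

variable [Fintype ι]

theorem freeMod_finite :
    Module.Finite Aᵐᵒᵖ (freeMod k A π).carrier :=
  haveI : Module.Finite Aᵐᵒᵖ A := ⟨{1}, by
    rw [eq_top_iff]
    intro a _
    rw [Finset.coe_singleton, Submodule.mem_span_singleton]
    exact ⟨MulOpposite.op a, one_mul a⟩⟩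
  inferInstanceAs (Module.Finite Aᵐᵒᵖ (ι → A))

theorem freeMod_projective : (freeMod k A π).IsProjective := by
  classical
  intro N N' g f hg hf hsurj
  let b : ι → (freeMod k A π).carrier := fun i => (Pi.single i 1 : ι → A)
  have hb : ∀ i, b i ∈ part k (M := (freeMod k A π).carrier) (π i) := by
    intro i j
    change (Pi.single i 1 : ι → A) j ∈ _
    rcases eq_or_ne j i with rfl | h
    · rw [Pi.single_eq_same, zmod2_add_self]; exact Superalgebra.one_mem
    · rw [Pi.single_eq_of_ne h]; exact Submodule.zero_mem _
  have hn : ∀ i, ∃ n : N.carrier, n ∈ part k (M := N.carrier) (π i) ∧ g n = f (b i) := by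
    intro i
    obtain ⟨n, hn⟩ := hsurj (f (b i))
    refine ⟨proj k (π i) n, proj_mem _ _, ?_⟩
    have := proj_map (k := k) 0 (fun n => g n) (map_add g) hg (π i) n
    rw [← this, hn, add_zero]
    have := hf _ _ (hb i)
    rw [add_zero] at this
    exact proj_of_mem this
  choose n hn hgn using hn
  refine ⟨{ toFun := fun v => ∑ i, MulOpposite.op ((v : ι → A) i) • n i
            map_add' := ?_
            map_smul' := ?_ }, ?_, ?_⟩
  · intro v w
    rw [← Finset.sum_add_distrib]
    exact Finset.sum_congr rfl fun i _ => add_smul _ _ _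
  · intro r v
    rw [RingHom.id_apply, Finset.smul_sum]
    exact Finset.sum_congr rfl fun i _ => mul_smul _ _ _
  · intro a v hv
    refine Submodule.sum_mem _ fun i _ => ?_
    have h := GradedAction.smul_mem (k := k) (a + π i) (π i) (MulOpposite.op ((v : ι → A) i))
      (n i) (hv i) (hn i)
    rw [add_assoc, zmod2_add_self] at h
    exact h
  · ext v
    change g (∑ i, MulOpposite.op ((v : ι → A) i) • n i) = f v
    rw [map_sum]
    have hv : v = ∑ i, MulOpposite.op ((v : ι → A) i) • b i := by
      have : ∀ j, (v : ι → A) j = (∑ i, MulOpposite.op ((v : ι → A) i) •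
          (Pi.single i 1 : ι → A)) j := by
        intro j
        rw [Finset.sum_apply, Finset.sum_eq_single j]
        · simp
        · intro i _ hij; simp [Pi.single_eq_of_ne hij.symm]
        · simp
      exact funext this
    conv_rhs => rw [hv, map_sum]
    exact Finset.sum_congr rfl fun i _ => by rw [map_smul, map_smul, hgn]

end Free

section Main

variable (k A : Type u) [CommRing k] [Ring A] [Algebra k A] [Superalgebra k A]

/-- The free right supermodule `A^{m|n} = A^m ⊕ (ΠA)^n`. -/
def freeMN (m n : ℕ) : RSMod k A :=
  freeMod k A (Sum.elim (fun _ : Fin m => (0 : ZMod 2)) (fun _ : Fin n => (1 : ZMod 2)))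

/-- The free right supermodule `A^n`. -/
def freeN (n : ℕ) : RSMod k A := freeMod k A (fun _ : Fin n => (0 : ZMod 2))

/-- `M` is finitely generated and projective. -/
def IsFGProj (M : RSMod k A) : Prop := Module.Finite Aᵐᵒᵖ M.carrier ∧ M.IsProjective

/-- `M` is evenly generated: there is an even surjective homomorphism `A^n → M` for some `n`. -/
def IsEvenlyGenerated (M : RSMod k A) : Prop :=
  ∃ (n : ℕ) (f : (freeN k A n).carrier →ₗ[Aᵐᵒᵖ] M.carrier),
    f ∈ part k (M := (freeN k A n).carrier →ₗ[Aᵐᵒᵖ] M.carrier) 0 ∧ Function.Surjective f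

/-- `𝒱_A`, the category of finitely generated projective right `A`-supermodules. -/
abbrev VCat : Type (u + 1) := FullSub (IsFGProj k A)

/-- `ℰ_A`, the category of evenly generated projective right `A`-supermodules. -/
abbrev ECat : Type (u + 1) := FullSub fun M : RSMod k A => IsFGProj k A M ∧ IsEvenlyGenerated k A M

/-- `A^{m|n}` as an object of `𝒱_A`. -/
def VCat.free (m n : ℕ) : VCat k A := ⟨freeMN k A m n, freeMod_finite k A _, freeMod_projective k A _⟩

/-- `A^n` as an object of `ℰ_A`. -/
def ECat.free (n : ℕ) : ECat k A :=
  ⟨freeN k A n, ⟨freeMod_finite k A _, freeMod_projective k A _⟩,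
    n, LinearMap.id, id_mem_part_hom (k := k) (R := Aᵐᵒᵖ) (M := (freeN k A n).carrier),
    Function.surjective_id⟩

/-- The superalgebra `M_{m|n}(A) = End_A(A^{m|n})`. -/
abbrev MatMN (m n : ℕ) : Type u := Module.End Aᵐᵒᵖ (freeMN k A m n).carrier

/-- The superalgebra `M_n(A) = End_A(A^n)`. -/
abbrev MatN (n : ℕ) : Type u := Module.End Aᵐᵒᵖ (freeN k A n).carrier

/-- The generalized Schur superalgebra `S^A(m|n, d) = Γ^d M_{m|n}(A)`. -/
abbrev SchurMN (m n d : ℕ) : Type u := divPow k d (MatMN k A m n)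

/-- The generalized Schur superalgebra `S^A(n, d) = Γ^d M_n(A)`. -/
abbrev SchurN (n d : ℕ) : Type u := divPow k d (MatN k A n)

end Main

/-! ### Evaluation -/

section Eval

variable {k A : Type u} [CommRing k] [Ring A] [Algebra k A] [Superalgebra k A]
  {Q : RSMod k A → Prop} (d : ℕ) (P : FullSub Q)

/-- An element of `Γ^d End_A(P)` as an endomorphism of `P` in `Γ^d C`. -/
def gammaEnd (s : divPow k d (Module.End Aᵐᵒᵖ P.obj.carrier)) :
    (Gamma.mk P : Gamma k d (FullSub Q)) ⟶ Gamma.mk P := s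

theorem gammaEnd_mul (s t : divPow k d (Module.End Aᵐᵒᵖ P.obj.carrier)) :
    gammaEnd d P (s * t) = gammaEnd d P t ≫ gammaEnd d P s := rfl

/-- `F(P)` as a left supermodule over `Γ^d End_A(P)`: an element `s` acts by `F(s)`. -/
def evalObj (F : Rep k (Gamma k d (FullSub Q))) :
    LSMod k (divPow k d (Module.End Aᵐᵒᵖ P.obj.carrier)) :=
  letI : Module (divPow k d (Module.End Aᵐᵒᵖ P.obj.carrier)) (F.obj ⟨P⟩).carrier :=
    { smul := fun s v => svHom (F.map (gammaEnd d P s)) v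
      one_smul := fun v => LinearMap.congr_fun (F.map_id ⟨P⟩) v
      mul_smul := fun s t v =>
        LinearMap.congr_fun (F.map_comp (gammaEnd d P t) (gammaEnd d P s)) v
      smul_zero := fun s => LinearMap.map_zero (svHom (F.map (gammaEnd d P s)))
      smul_add := fun s => LinearMap.map_add (svHom (F.map (gammaEnd d P s)))
      add_smul := fun s t v =>
        LinearMap.congr_fun (F.map_add (gammaEnd d P s) (gammaEnd d P t)) v
      zero_smul := fun v => by
        have h := F.map_smul (0 : k) (gammaEnd d P 0)
        rw [zero_smul, zero_smul] at h
        exact LinearMap.congr_fun h v }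
  { carrier := (F.obj ⟨P⟩).carrier
    tower := ⟨fun c s v => LinearMap.congr_fun (F.map_smul c (gammaEnd d P s)) v⟩
    graded := ⟨fun i j s v hs hv => by
      rw [add_comm]
      exact F.map_mem i (gammaEnd d P s) hs j v hv⟩ }

theorem evalObj_smul (F : Rep k (Gamma k d (FullSub Q)))
    (s : divPow k d (Module.End Aᵐᵒᵖ P.obj.carrier)) (v : (evalObj d P F).carrier) :
    s • v = svHom (F.map (gammaEnd d P s)) v := rfl

/-- Evaluation at `P`, as an even `k`-linear functor from `rep Γ^d C` to left supermodules over
`Γ^d End_A(P)`: `F ↦ F(P)` and `η ↦ η(P)`. -/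
def evaluation : SuperFunctor k (Rep k (Gamma k d (FullSub Q)))
    (LSMod k (divPow k d (Module.End Aᵐᵒᵖ P.obj.carrier))) where
  obj F := evalObj d P F
  map {F G} η := ⟨svHom (η.1 ⟨P⟩), fun i j s v hs => by
    have h := η.2 i j _ _ (gammaEnd d P s) hs
    have h2 : sgn k (i * j) • (svHom (proj k j (η.1 ⟨P⟩)) (svHom (F.map (gammaEnd d P s)) v)) =
        svHom (G.map (gammaEnd d P s)) (svHom (proj k j (η.1 ⟨P⟩)) v) :=
      (LinearMap.congr_fun h v).symm
    have h3 := congrArg (fun x => sgn k (i * j) • x) h2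
    simp only [smul_smul, sgn_mul_self, one_smul] at h3
    exact h3⟩
  map_id F := rfl
  map_comp η θ := rfl
  map_add η θ := rfl
  map_smul c η := rfl
  map_mem i η hη := hη ⟨P⟩ trivial

end Eval

end SuperPoly

end

/-!
The proof is a Morita argument. Put `C = Γ^d 𝒱_A` (or `Γ^d ℰ_A`), let `P` be the free object at which
functors are evaluated, and let `E = Γ^d End_A(P)` be its endomorphism superalgebra. Everything
rests on one fact: every identity morphism of `C` is a finite sum of composites `X ⟶ P ⟶ X` of *even*
morphisms (`EvenlyGenerates`).

Given this, an enriched transformation `η : F ⟶ G` satisfies `η(X) = ∑ F(fᵢ) ≫ η(P) ≫ G(gᵢ)` when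
`𝟙 X = ∑ fᵢ ≫ gᵢ`, because even morphisms commute with `η` without signs. So `η` is determined by
`η(P)`, and the same formula extends any `E`-supercommuting map `F(P) ⟶ G(P)`
(`superNatTrans_ext`, `exists_superNatTrans`). For an `E`-supermodule `N`, the functor
`X ↦ Hom_E(Hom(X, P), N)` (`coind`) has value `N` at `P`; the factorization of `𝟙 X` exhibits each of
its values as a direct summand of a finite power of `N`, hence as finitely generated and projective
over `k` (`exists_coind_retraction`).

To see that `P` generates, write the object `X` as an even direct summand of a free supermodule `A^π`
in the category of supermodules. Then `𝟙 X = ∑ xᵢ`, where `xᵢ` is even and passes through the `i`-th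
summand of `A^π`. By inclusion-exclusion, `(∑ xᵢ)^{⊗d}` is an integral combination of the powers
`(∑_{i ∈ S} xᵢ)^{⊗d}` with `|S| ≤ d` (`sum_neg_one_pow_card_multilinear`,
`mem_span_of_alternating_sum`), since a product of `d` factors involves at most `d` indices. As `P`
has at least `d` basis vectors of each parity that is needed, `∑_{i ∈ S} xᵢ` factors through `P` by
even maps for such `S` (`exists_sum_eq_id`), and so does its `d`-th tensor power.
-/

noncomputable section

namespace SuperPoly

open CategoryTheory

/-! ### Objects through which identities factor -/

section Generator

variable {k : Type w} [CommRing k] {C : Type*} [Category* C] [Preadditive C]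
  [Linear k C] [SuperCategory k C]

/-- `P` generates `C` evenly: every identity morphism of `C` is a finite sum of composites
`X ⟶ P ⟶ X` of even morphisms. -/
def EvenlyGenerates (k : Type w) [CommRing k] {C : Type*} [Category* C] [Preadditive C]
    [Linear k C] [SuperCategory k C] (P : C) : Prop :=
  ∀ X : C, ∃ (r : ℕ) (f : Fin r → (X ⟶ P)) (g : Fin r → (P ⟶ X)),
    (∀ i, f i ∈ part k (M := X ⟶ P) 0) ∧ (∀ i, g i ∈ part k (M := P ⟶ X) 0) ∧
      ∑ i, f i ≫ g i = 𝟙 X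

theorem evenlyGenerates_of_mem_span {P : C}
    (h : ∀ X : C, 𝟙 X ∈ Submodule.span k {e : X ⟶ X | ∃ (f : X ⟶ P) (g : P ⟶ X),
      f ∈ part k (M := X ⟶ P) 0 ∧ g ∈ part k (M := P ⟶ X) 0 ∧ f ≫ g = e}) :
    EvenlyGenerates k P := by
  intro X
  obtain ⟨r, c, e, he⟩ := Submodule.mem_span_set'.1 (h X)
  choose f g hf hg hfg using fun i => (e i).2
  refine ⟨r, fun i => c i • f i, g, fun i => Submodule.smul_mem _ _ (hf i), hg, ?_⟩
  rw [← he]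
  exact Finset.sum_congr rfl fun i _ => by rw [Linear.smul_comp, hfg]

theorem proj_comp_left {X Y Z : C} (j : ZMod 2) {f : X ⟶ Y} (hf : f ∈ part k (M := X ⟶ Y) 0)
    (g : Y ⟶ Z) : proj k j (f ≫ g) = f ≫ proj k j g := by
  have := proj_map (k := k) 0 (fun g : Y ⟶ Z => f ≫ g) (fun _ _ => Preadditive.comp_add _ _ _ _ _ _)
    (fun j g hg => by rw [add_comm]; exact SuperCategory.comp_mem 0 j f g hf hg) j g
  rwa [add_zero] at this

variable {D : Type*} [Category* D] [Preadditive D] [Linear k D] [SuperCategory k D]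

theorem SuperFunctor.map_sum (F : SuperFunctor k C D) {X Y : C} {ι : Type*} (s : Finset ι)
    (f : ι → (X ⟶ Y)) : F.map (∑ i ∈ s, f i) = ∑ i ∈ s, F.map (f i) :=
  _root_.map_sum (AddMonoidHom.mk' (fun f : X ⟶ Y => F.map f) F.map_add) f s

variable {F G : SuperFunctor k C D}

/-- Enriched transformations commute with even morphisms without a sign. -/
theorem superNatTrans_even {η : ∀ X : C, F.obj X ⟶ G.obj X} (hη : η ∈ superNatTrans F G)
    {X Y : C} {φ : X ⟶ Y} (hφ : φ ∈ part k (M := X ⟶ Y) 0) :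
    η X ≫ G.map φ = F.map φ ≫ η Y := by
  rw [← sum_proj (k := k) (η X), ← sum_proj (k := k) (η Y), Preadditive.sum_comp,
    Preadditive.comp_sum]
  refine Finset.sum_congr rfl fun j _ => ?_
  rw [hη 0 j X Y φ hφ, zero_mul, sgn_zero, one_smul]

variable {P : C}

theorem superNatTrans_eq_sum {η : ∀ X : C, F.obj X ⟶ G.obj X} (hη : η ∈ superNatTrans F G)
    {X : C} {r : ℕ} {f : Fin r → (X ⟶ P)} {g : Fin r → (P ⟶ X)}
    (hf : ∀ i, f i ∈ part k (M := X ⟶ P) 0) (hfg : ∑ i, f i ≫ g i = 𝟙 X) :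
    η X = ∑ i, F.map (f i) ≫ η P ≫ G.map (g i) := by
  have h : η X ≫ G.map (∑ i, f i ≫ g i) = η X := by rw [hfg, G.map_id, Category.comp_id]
  rw [← h, SuperFunctor.map_sum, Preadditive.comp_sum]
  refine Finset.sum_congr rfl fun i _ => ?_
  rw [G.map_comp, ← Category.assoc, superNatTrans_even hη (hf i), Category.assoc]

theorem superNatTrans_ext (hP : EvenlyGenerates k P) {η θ : ∀ X : C, F.obj X ⟶ G.obj X}
    (hη : η ∈ superNatTrans F G) (hθ : θ ∈ superNatTrans F G) (h : η P = θ P) : η = θ := by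
  funext X
  obtain ⟨r, f, g, hf, hg, hfg⟩ := hP X
  rw [superNatTrans_eq_sum hη hf hfg, superNatTrans_eq_sum hθ hf hfg, h]

/-- A morphism `F(P) ⟶ G(P)` that supercommutes with the endomorphisms of a generator `P` extends
to an enriched transformation: along `∑ fᵢ ≫ gᵢ = 𝟙 X`, its value at `X` has to be
`∑ F(fᵢ) ≫ h ≫ G(gᵢ)`. -/
theorem exists_superNatTrans (hP : EvenlyGenerates k P) (h : F.obj P ⟶ G.obj P)
    (hh : ∀ (i j : ZMod 2) (s : P ⟶ P), s ∈ part k (M := P ⟶ P) i →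
      proj k j h ≫ G.map s = sgn k (i * j) • (F.map s ≫ proj k j h)) :
    ∃ η ∈ superNatTrans F G, η P = h := by
  choose r f g hf hg hfg using hP
  have hproj : ∀ (j : ZMod 2) (X : C),
      proj k j (∑ a, F.map (f X a) ≫ h ≫ G.map (g X a)) =
        ∑ a, F.map (f X a) ≫ proj k j h ≫ G.map (g X a) := by
    intro j X
    rw [map_sum]
    refine Finset.sum_congr rfl fun a _ => ?_
    have := proj_comp_right (k := k) 0 j h (G.map_mem 0 _ (hg X a))
    rw [add_zero] at this
    rw [proj_comp_left j (F.map_mem 0 _ (hf X a)), this]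
  have hη : (fun X => ∑ a, F.map (f X a) ≫ h ≫ G.map (g X a)) ∈ superNatTrans F G := by
    intro i j X Y φ hφ
    -- Both sides equal a double sum over the factorizations of `𝟙 X` and of `𝟙 Y`.
    have key : ∀ a b, (F.map (f X a) ≫ proj k j h ≫ G.map (g X a)) ≫
        G.map (φ ≫ f Y b ≫ g Y b) =
        sgn k (i * j) • (F.map ((f X a ≫ g X a) ≫ φ) ≫
          (F.map (f Y b) ≫ proj k j h ≫ G.map (g Y b))) := by
      intro a b
      have hs : g X a ≫ φ ≫ f Y b ∈ part k (M := P ⟶ P) i := by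
        have h1 := SuperCategory.comp_mem i 0 φ (f Y b) hφ (hf Y b)
        have h2 := SuperCategory.comp_mem 0 (i + 0) (g X a) _ (hg X a) h1
        rwa [zero_add, add_zero] at h2
      have h3 := hh i j _ hs
      calc _ = F.map (f X a) ≫ (proj k j h ≫ G.map (g X a ≫ φ ≫ f Y b)) ≫ G.map (g Y b) := by
            simp only [Functor.map_comp, Category.assoc]
        _ = _ := by
            rw [h3]
            simp only [Functor.map_comp, Category.assoc, Linear.smul_comp, Linear.comp_smul]
    simp only [hproj]
    have e1 : G.map φ = ∑ b, G.map (φ ≫ f Y b ≫ g Y b) := by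
      rw [← SuperFunctor.map_sum, ← Preadditive.comp_sum, hfg, Category.comp_id]
    have e2 : F.map φ = ∑ a, F.map ((f X a ≫ g X a) ≫ φ) := by
      rw [← SuperFunctor.map_sum, ← Preadditive.sum_comp, hfg, Category.id_comp]
    rw [e1, e2]
    simp only [Preadditive.sum_comp, Preadditive.comp_sum, Finset.smul_sum, key]
  refine ⟨_, hη, ?_⟩
  have hcomm : ∀ s : P ⟶ P, s ∈ part k (M := P ⟶ P) 0 → h ≫ G.map s = F.map s ≫ h := by
    intro s hs
    rw [← sum_proj (k := k) h, Preadditive.sum_comp, Preadditive.comp_sum]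
    refine Finset.sum_congr rfl fun j _ => ?_
    rw [hh 0 j s hs, zero_mul, sgn_zero, one_smul]
  have : ∀ a, F.map (f P a) ≫ h ≫ G.map (g P a) = F.map (f P a ≫ g P a) ≫ h := fun a => by
    rw [hcomm _ (hg P a), F.map_comp, Category.assoc]
  simp only [this]
  rw [← Preadditive.sum_comp, ← SuperFunctor.map_sum, hfg, F.map_id, Category.id_comp]

end Generator

/-! ### Extending a module over the endomorphisms of a generator -/

section Coinduction

variable {k A : Type u} [CommRing k] [Ring A] [Algebra k A] [Superalgebra k A]
  {Q : RSMod k A → Prop} (d : ℕ) (P : FullSub Q)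

/-- `Hom(X, P)` as a left supermodule over `Γ^d End_A(P)`, acting by composition. -/
instance homToModule (X : Gamma k d (FullSub Q)) :
    Module (divPow k d (Module.End Aᵐᵒᵖ P.obj.carrier)) (X ⟶ Gamma.mk P) where
  smul s f := f ≫ gammaEnd d P s
  one_smul f := Category.comp_id f
  mul_smul s t f := (Category.assoc f (gammaEnd d P t) (gammaEnd d P s)).symm
  smul_zero s := Limits.zero_comp
  smul_add s f g := Preadditive.add_comp _ _ _ _ _ _
  add_smul s t f := Preadditive.comp_add _ _ _ f (gammaEnd d P s) (gammaEnd d P t)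
  zero_smul f := Limits.comp_zero

theorem homTo_smul (X : Gamma k d (FullSub Q))
    (s : divPow k d (Module.End Aᵐᵒᵖ P.obj.carrier)) (f : X ⟶ Gamma.mk P) :
    s • f = f ≫ gammaEnd d P s := rfl

instance homToTower (X : Gamma k d (FullSub Q)) :
    IsScalarTower k (divPow k d (Module.End Aᵐᵒᵖ P.obj.carrier)) (X ⟶ Gamma.mk P) :=
  ⟨fun c s f => Linear.comp_smul _ _ _ f c (gammaEnd d P s)⟩

instance homToGraded (X : Gamma k d (FullSub Q)) :
    GradedAction k (divPow k d (Module.End Aᵐᵒᵖ P.obj.carrier)) (X ⟶ Gamma.mk P) :=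
  ⟨fun i j s f hs hf => by
    rw [add_comm]
    exact SuperCategory.comp_mem (k := k) j i f (gammaEnd d P s) hf hs⟩

variable (N : LSMod k (divPow k d (Module.End Aᵐᵒᵖ P.obj.carrier)))

/-- The `Γ^d End_A(P)`-linear maps `Hom(X, P) → N`. -/
abbrev Coind (X : Gamma k d (FullSub Q)) : Type u :=
  (X ⟶ Gamma.mk P) →ₗ[divPow k d (Module.End Aᵐᵒᵖ P.obj.carrier)] N.carrier

variable {d P}

/-- Precomposition with `φ : X ⟶ Y`, as a map `Hom(Hom(X, P), N) → Hom(Hom(Y, P), N)`. No sign is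
needed, since `φ` acts on the side opposite to the scalars. -/
def coindMap {X Y : Gamma k d (FullSub Q)} (φ : X ⟶ Y) :
    Coind d P N X →ₗ[k] Coind d P N Y where
  toFun θ :=
    { toFun := fun f => θ (φ ≫ f)
      map_add' := fun f g => by rw [Preadditive.comp_add, map_add]
      map_smul' := fun s f => by
        rw [homTo_smul, ← Category.assoc, RingHom.id_apply, ← map_smul, homTo_smul] }
  map_add' θ θ' := rfl
  map_smul' c θ := rfl

theorem coindMap_apply {X Y : Gamma k d (FullSub Q)} (φ : X ⟶ Y) (θ : Coind d P N X)
    (f : Y ⟶ Gamma.mk P) : coindMap N φ θ f = θ (φ ≫ f) := rfl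

theorem coindMap_mem {X Y : Gamma k d (FullSub Q)} {i : ZMod 2} {φ : X ⟶ Y}
    (hφ : φ ∈ part k (M := X ⟶ Y) i) :
    coindMap N φ ∈ part k (M := Coind d P N X →ₗ[k] Coind d P N Y) i := by
  intro j θ hθ a f hf
  have h := hθ _ _ (SuperCategory.comp_mem (k := k) i a φ f hφ hf)
  rwa [show i + a + j = a + (j + i) by ring] at h

theorem coind_apply_id (θ : Coind d P N (Gamma.mk P))
    (s : divPow k d (Module.End Aᵐᵒᵖ P.obj.carrier)) :
    θ (gammaEnd d P s) = s • θ (𝟙 (Gamma.mk P)) :=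
  (congrArg θ (Category.id_comp (gammaEnd d P s)).symm).trans (θ.map_smul s (𝟙 (Gamma.mk P)))

/-- The map `N → Hom(Hom(X, P), N)` sending `n` to `f ↦ (f ∘ g) n`, for `g : P ⟶ X`. -/
def toCoind {X : Gamma k d (FullSub Q)} (g : Gamma.mk P ⟶ X) : N.carrier →ₗ[k] Coind d P N X where
  toFun n :=
    { toFun := fun f => (show divPow k d (Module.End Aᵐᵒᵖ P.obj.carrier) from g ≫ f) • n
      map_add' := fun f f' =>
        (congrArg (fun s : divPow k d (Module.End Aᵐᵒᵖ P.obj.carrier) => s • n)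
          (Preadditive.comp_add _ _ _ g f f')).trans (add_smul _ _ n)
      map_smul' := fun s f =>
        (congrArg (fun s : divPow k d (Module.End Aᵐᵒᵖ P.obj.carrier) => s • n)
          (Category.assoc g f (gammaEnd d P s)).symm).trans (mul_smul s _ n) }
  map_add' n n' := LinearMap.ext fun f => smul_add
    (show divPow k d (Module.End Aᵐᵒᵖ P.obj.carrier) from g ≫ f) n n'
  map_smul' c n := LinearMap.ext fun f => smul_comm
    (show divPow k d (Module.End Aᵐᵒᵖ P.obj.carrier) from g ≫ f) c n

theorem toCoind_apply {X : Gamma k d (FullSub Q)} (g : Gamma.mk P ⟶ X) (n : N.carrier)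
    (f : X ⟶ Gamma.mk P) (s : divPow k d (Module.End Aᵐᵒᵖ P.obj.carrier))
    (h : g ≫ f = gammaEnd d P s) : toCoind N g n f = s • n :=
  congrArg (fun s : divPow k d (Module.End Aᵐᵒᵖ P.obj.carrier) => s • n) h

theorem toCoind_coind {X : Gamma k d (FullSub Q)} (g : Gamma.mk P ⟶ X) (f : X ⟶ Gamma.mk P)
    (θ : Coind d P N X) : toCoind N g (θ f) = coindMap N (f ≫ g) θ := by
  refine LinearMap.ext fun h => ?_
  rw [toCoind_apply N g (θ f) h (g ≫ h) rfl, ← map_smul, coindMap_apply, Category.assoc]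
  rfl

theorem coindMap_id (X : Gamma k d (FullSub Q)) (θ : Coind d P N X) :
    coindMap N (𝟙 X) θ = θ :=
  LinearMap.ext fun f => congrArg θ (Category.id_comp f)

theorem coindMap_add {X Y : Gamma k d (FullSub Q)} (φ ψ : X ⟶ Y) :
    coindMap (P := P) N (φ + ψ) = coindMap N φ + coindMap N ψ :=
  LinearMap.ext fun θ => LinearMap.ext fun f =>
    (congrArg θ (Preadditive.add_comp _ _ _ φ ψ f)).trans (map_add θ _ _)

/-- A factorization of `𝟙 X` through `P` makes `Hom(Hom(X, P), N)` a direct summand of a finite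
power of `N`. -/
theorem exists_coind_retraction (hP : EvenlyGenerates k (Gamma.mk P : Gamma k d (FullSub Q)))
    (X : Gamma k d (FullSub Q)) :
    ∃ (r : ℕ) (p : Coind d P N X →ₗ[k] (Fin r → N.carrier))
      (q : (Fin r → N.carrier) →ₗ[k] Coind d P N X), q ∘ₗ p = LinearMap.id := by
  obtain ⟨r, f, g, -, -, hfg⟩ := hP X
  refine ⟨r, LinearMap.pi fun a =>
    { toFun := fun θ => θ (f a)
      map_add' := fun _ _ => rfl
      map_smul' := fun _ _ => rfl }, ∑ a, toCoind N (g a) ∘ₗ LinearMap.proj a, ?_⟩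
  refine LinearMap.ext fun θ => ?_
  rw [LinearMap.comp_apply, LinearMap.sum_apply]
  change ∑ a, toCoind N (g a) (θ (f a)) = θ
  simp only [toCoind_coind]
  have h := map_sum (AddMonoidHom.mk' (fun φ : X ⟶ X => coindMap (P := P) N φ) (coindMap_add N))
    (fun a => f a ≫ g a) Finset.univ
  rw [hfg] at h
  refine Eq.trans ?_ (coindMap_id N X θ)
  refine Eq.trans ?_ (LinearMap.congr_fun h θ).symm
  exact (LinearMap.sum_apply _ _ _).symm

/-- The functor `X ↦ Hom(Hom(X, P), N)` for a generator `P`. -/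
def coind (hP : EvenlyGenerates k (Gamma.mk P : Gamma k d (FullSub Q))) :
    Rep k (Gamma k d (FullSub Q)) where
  obj X :=
    { carrier := Coind d P N X
      finite := by
        obtain ⟨r, p, q, h⟩ := exists_coind_retraction N hP X
        exact Module.Finite.of_surjective q fun x => ⟨p x, LinearMap.congr_fun h x⟩
      projective := by
        obtain ⟨r, p, q, h⟩ := exists_coind_retraction N hP X
        have : Module.Projective k (Fin r → N.carrier) :=
          .of_equiv (DFinsupp.linearEquivFunOnFintype (R := k) (M := fun _ : Fin r => N.carrier))
        exact Module.Projective.of_split p q h }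
  map φ := coindMap N φ
  map_id X := LinearMap.ext (coindMap_id N X)
  map_comp φ ψ := LinearMap.ext fun θ => LinearMap.ext fun f =>
    congrArg θ (Category.assoc φ ψ f)
  map_add φ ψ := coindMap_add N φ ψ
  map_smul c φ := LinearMap.ext fun θ => LinearMap.ext fun f =>
    (congrArg θ (Linear.smul_comp _ _ _ c φ f)).trans (θ.map_smul_of_tower c _)
  map_mem i φ hφ := coindMap_mem N hφ

/-- An even linear bijection that commutes with the scalars without signs is an even isomorphism. -/
theorem LSMod.exists_iso {E : Type u} [Ring E] [Algebra k E] [Superalgebra k E] {M N : LSMod k E}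
    (e : M.carrier ≃ₗ[E] N.carrier)
    (he : ∀ (a : ZMod 2) (m : M.carrier), m ∈ part k (M := M.carrier) a →
      e m ∈ part k (M := N.carrier) a) :
    ∃ i : M ≅ N, i.hom ∈ part k (M := M ⟶ N) 0 := by
  have hs : ∀ (a : ZMod 2) (n : N.carrier), n ∈ part k (M := N.carrier) a →
      e.symm n ∈ part k (M := M.carrier) a := by
    intro a n hn
    have h := proj_map (k := k) 0 e (map_add e) (fun j x hx => by rw [add_zero]; exact he j x hx)
      a (e.symm n)
    rw [add_zero, e.apply_symm_apply, proj_of_mem hn] at h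
    rw [h, e.symm_apply_apply]
    exact proj_mem _ _
  have hom : ∀ {M N : LSMod k E} (f : M.carrier →ₗ[E] N.carrier),
      (f.restrictScalars k) ∈ part k (M := M.carrier →ₗ[k] N.carrier) 0 →
      f.restrictScalars k ∈ leftHom M N := by
    intro M N f hf i j s v hs
    by_cases hj : j = 0
    · subst hj
      rw [proj_of_mem hf, mul_zero, sgn_zero, one_smul]
      exact map_smul f s v
    · rw [proj_of_mem_ne hf hj]
      simp
  have h1 : (e.toLinearMap.restrictScalars k) ∈
      part k (M := M.carrier →ₗ[k] N.carrier) 0 := fun a m hm => by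
    rw [add_zero]; exact he a m hm
  have h2 : (e.symm.toLinearMap.restrictScalars k) ∈
      part k (M := N.carrier →ₗ[k] M.carrier) 0 := fun a m hm => by
    rw [add_zero]; exact hs a m hm
  exact ⟨⟨⟨_, hom _ h1⟩, ⟨_, hom _ h2⟩,
    Subtype.ext (LinearMap.ext fun m => e.symm_apply_apply m),
    Subtype.ext (LinearMap.ext fun m => e.apply_symm_apply m)⟩, h1⟩

/-- Evaluation at the identity of `P` recovers `N` from `X ↦ Hom(Hom(X, P), N)`. -/
def evalCoindEquiv (hP : EvenlyGenerates k (Gamma.mk P : Gamma k d (FullSub Q))) :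
    (evalObj d P (coind N hP)).carrier
      ≃ₗ[divPow k d (Module.End Aᵐᵒᵖ P.obj.carrier)] N.carrier where
  toFun := fun θ : Coind d P N (Gamma.mk P) => θ (𝟙 (Gamma.mk P))
  map_add' θ θ' := rfl
  map_smul' := fun s (θ : Coind d P N (Gamma.mk P)) =>
    (congrArg θ (Category.comp_id (gammaEnd d P s))).trans (coind_apply_id N θ s)
  invFun n := toCoind N (𝟙 (Gamma.mk P)) n
  left_inv := fun θ : Coind d P N (Gamma.mk P) =>
    (toCoind_coind N (𝟙 (Gamma.mk P)) (𝟙 (Gamma.mk P)) θ).trans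
      ((congrArg (fun φ => coindMap N φ θ) (Category.comp_id _)).trans (coindMap_id N _ θ))
  right_inv n := (toCoind_apply N (𝟙 (Gamma.mk P)) n (𝟙 (Gamma.mk P)) 1 (Category.comp_id _)).trans
    (one_smul _ n)

/-- Morita theorem: evaluation at a generator of `Γ^d C` is an equivalence. -/
theorem evaluation_isSuperEquivalence
    (hP : EvenlyGenerates k (Gamma.mk P : Gamma k d (FullSub Q))) :
    (evaluation (k := k) d P).IsSuperEquivalence := by
  have surj : ∀ N : LSMod k (divPow k d (Module.End Aᵐᵒᵖ P.obj.carrier)),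
      ∃ (F : Rep k (Gamma k d (FullSub Q))) (e : (evaluation d P).obj F ≅ N),
        e.hom ∈ part k (M := (evaluation d P).obj F ⟶ N) 0 := fun N =>
    ⟨coind N hP, LSMod.exists_iso (M := evalObj d P (coind N hP)) (evalCoindEquiv N hP)
      fun a θ hθ => by
        have h := hθ 0 (𝟙 (Gamma.mk P)) (SuperCategory.id_mem (k := k) (Gamma.mk P))
        rwa [zero_add] at h⟩
  refine ⟨{ faithful := ⟨fun {F G} η θ h => ?_⟩, full := ⟨fun {F G} h => ?_⟩,
            essSurj := ⟨fun N => ?_⟩ }, surj⟩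
  · exact Subtype.ext (superNatTrans_ext hP η.2 θ.2 (congrArg Subtype.val h))
  · obtain ⟨η, hη, hh⟩ := exists_superNatTrans hP (F := F) (G := G) h.1 fun i j s hs => by
      refine LinearMap.ext fun v => ?_
      have h1 := h.2 i j s v hs
      have h2 := congrArg (fun x => sgn k (i * j) • x) h1
      simp only [smul_smul, sgn_mul_self, one_smul] at h2
      exact h2.symm
    exact ⟨⟨η, hη⟩, Subtype.ext hh⟩
  · obtain ⟨F, e, -⟩ := surj N
    exact ⟨F, ⟨e⟩⟩

end Coinduction

/-! ### Inclusion-exclusion for powers of a sum -/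

section InclusionExclusion

theorem sum_neg_one_pow_card_superset {ι : Type*} [DecidableEq ι] {T U : Finset ι} (hU : U ⊂ T) :
    ∑ S ∈ T.powerset with U ⊆ S, (-1 : ℤ) ^ S.card = 0 := by
  obtain ⟨t, htT, htU⟩ := Finset.exists_of_ssubset hU
  refine Finset.sum_involution (fun S _ => if t ∈ S then S.erase t else insert t S) ?_ ?_ ?_ ?_
  · intro S _
    split_ifs with h
    · rw [← Finset.card_erase_add_one h, pow_succ]; ring
    · rw [Finset.card_insert_of_notMem h, pow_succ]; ring
  · intro S _ _
    split_ifs with h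
    · exact fun e => (Finset.erase_eq_self.1 e) h
    · exact fun e => h (Finset.insert_eq_self.1 e)
  · intro S hS
    simp only [Finset.mem_filter, Finset.mem_powerset] at hS ⊢
    split_ifs with h
    · exact ⟨(Finset.erase_subset _ _).trans hS.1, Finset.subset_erase.2 ⟨hS.2, htU⟩⟩
    · exact ⟨Finset.insert_subset htT hS.1, hS.2.trans (Finset.subset_insert _ _)⟩
  · intro S _
    by_cases h : t ∈ S
    · simp [h, Finset.insert_erase]
    · simp [h]

/-- The alternating sum of a multilinear map in `d` variables over the diagonal vectors
`∑ i ∈ S, x i` with `S ⊆ T` vanishes if `T` has more than `d` elements: `d` factors cannot involve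
all the indices in `T`. -/
theorem sum_neg_one_pow_card_multilinear {k : Type*} [CommRing k] {M N : Type*} [AddCommGroup M]
    [Module k M] [AddCommGroup N] [Module k N] {d : ℕ}
    (f : MultilinearMap k (fun _ : Fin d => M) N) {ι : Type*} [DecidableEq ι] (x : ι → M)
    (T : Finset ι) (hT : d < T.card) :
    ∑ S ∈ T.powerset, (-1 : ℤ) ^ S.card • f (fun _ => ∑ i ∈ S, x i) = 0 := by
  have h1 : ∀ S ∈ T.powerset, (-1 : ℤ) ^ S.card • f (fun _ => ∑ i ∈ S, x i) =
      ∑ φ ∈ Fintype.piFinset (fun _ : Fin d => T), if Finset.univ.image φ ⊆ S then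
        (-1 : ℤ) ^ S.card • f (fun a => x (φ a)) else 0 := by
    intro S hS
    rw [f.map_sum_finset (fun _ i => x i) (fun _ => S), Finset.smul_sum, ← Finset.sum_filter]
    refine Finset.sum_congr ?_ fun _ _ => rfl
    ext φ
    simp only [Fintype.mem_piFinset, Finset.mem_filter, Finset.image_subset_iff,
      Finset.mem_univ, true_implies]
    exact ⟨fun h => ⟨fun a => Finset.mem_powerset.1 hS (h a), h⟩, fun h => h.2⟩
  rw [Finset.sum_congr rfl h1, Finset.sum_comm]
  refine Finset.sum_eq_zero fun φ hφ => ?_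
  rw [← Finset.sum_filter, ← Finset.sum_smul, sum_neg_one_pow_card_superset, zero_smul]
  rw [Finset.ssubset_iff_subset_ne]
  refine ⟨Finset.image_subset_iff.2 fun a _ => Fintype.mem_piFinset.1 hφ a, fun h => ?_⟩
  have h2 := Finset.card_image_le (s := Finset.univ) (f := φ)
  rw [h, Finset.card_univ, Fintype.card_fin] at h2
  omega

theorem mem_span_of_alternating_sum {k V ι : Type*} [CommRing k] [AddCommGroup V] [Module k V]
    {d : ℕ} (F : Finset ι → V)
    (h : ∀ T : Finset ι, d < T.card → ∑ S ∈ T.powerset, (-1 : ℤ) ^ S.card • F S = 0)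
    (T : Finset ι) : F T ∈ Submodule.span k {v | ∃ S : Finset ι, S.card ≤ d ∧ F S = v} := by
  classical
  induction T using Finset.strongInduction with
  | H T ih =>
    by_cases hT : T.card ≤ d
    · exact Submodule.subset_span ⟨T, hT, rfl⟩
    have h1 := h T (not_le.1 hT)
    rw [← Finset.insert_erase (Finset.mem_powerset_self T),
      Finset.sum_insert (Finset.notMem_erase _ _), add_eq_zero_iff_eq_neg] at h1
    have h2 : F T = (-1 : ℤ) ^ T.card • ((-1 : ℤ) ^ T.card • F T) := by
      rw [smul_smul, ← mul_pow]; simp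
    rw [h2, h1]
    refine zsmul_mem (neg_mem (Submodule.sum_mem _ fun S hS => zsmul_mem (ih S ?_) _)) _
    rw [Finset.mem_erase, Finset.mem_powerset] at hS
    exact hS.2.ssubset_of_ne hS.1

end InclusionExclusion

/-! ### Identities in `Γ^d C` -/

section Gamma

variable (k : Type v) [CommRing k] (d : ℕ) {C : Type u} [Category.{v} C] [Preadditive C]
  [Linear k C] [SuperCategory k C]

/-- The morphism `φ ⊗ ⋯ ⊗ φ` of `Γ^d C`, for an even morphism `φ` of `C`. -/
def gammaPow {X Y : C} (φ : X ⟶ Y) (hφ : φ ∈ part k (M := X ⟶ Y) 0) :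
    (Gamma.mk X : Gamma k d C) ⟶ Gamma.mk Y :=
  ⟨tpure k d φ, tpure_mem_divPow hφ⟩

theorem gammaPow_mem_part {X Y : C} (φ : X ⟶ Y) (hφ : φ ∈ part k (M := X ⟶ Y) 0) :
    gammaPow k d φ hφ ∈ part k (M := (Gamma.mk X : Gamma k d C) ⟶ Gamma.mk Y) 0 :=
  tpure_mem_part hφ

theorem gammaPow_comp {X Y Z : C} (φ : X ⟶ Y) (hφ : φ ∈ part k (M := X ⟶ Y) 0) (ψ : Y ⟶ Z)
    (hψ : ψ ∈ part k (M := Y ⟶ Z) 0) (h : φ ≫ ψ ∈ part k (M := X ⟶ Z) 0) :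
    gammaPow k d φ hφ ≫ gammaPow k d ψ hψ = gammaPow k d (φ ≫ ψ) h := by
  refine Subtype.ext ?_
  change star d (compBilin k X Y Z) (tpure k d ψ) (tpure k d φ) = tpure k d (φ ≫ ψ)
  rw [tpure, tpure, star_tprod _ (ε := fun _ => 0) (δ := fun _ => 0) (fun _ => hψ) (fun _ => hφ)]
  simp [koszul, tpure, compBilin]

/-- If `𝟙 X` is a sum of even endomorphisms such that every sum of at most `d` of them factors
through `P`, then in `Γ^d C` the identity of `X` is a combination of morphisms that factor
through `P`. -/
theorem gamma_id_mem_span {X P : C} {ι : Type*} [Fintype ι] (x : ι → (X ⟶ X))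
    (hx : ∀ i, x i ∈ part k (M := X ⟶ X) 0) (hsum : ∑ i, x i = 𝟙 X)
    (hP : ∀ S : Finset ι, S.card ≤ d → ∃ (f : X ⟶ P) (g : P ⟶ X),
      f ∈ part k (M := X ⟶ P) 0 ∧ g ∈ part k (M := P ⟶ X) 0 ∧ f ≫ g = ∑ i ∈ S, x i) :
    𝟙 (Gamma.mk X : Gamma k d C) ∈ Submodule.span k
      {e : (Gamma.mk X : Gamma k d C) ⟶ Gamma.mk X |
        ∃ (f : (Gamma.mk X : Gamma k d C) ⟶ Gamma.mk P) (g : Gamma.mk P ⟶ Gamma.mk X),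
          f ∈ part k (M := (Gamma.mk X : Gamma k d C) ⟶ Gamma.mk P) 0 ∧
          g ∈ part k (M := (Gamma.mk P : Gamma k d C) ⟶ Gamma.mk X) 0 ∧ f ≫ g = e} := by
  classical
  have hS : ∀ S : Finset ι, ∑ i ∈ S, x i ∈ part k (M := X ⟶ X) 0 := fun S =>
    Submodule.sum_mem _ fun i _ => hx i
  have h := mem_span_of_alternating_sum (k := k) (d := d)
    (fun S => gammaPow k d (∑ i ∈ S, x i) (hS S)) (fun T hT => by
      have h1 := sum_neg_one_pow_card_multilinear
        (PiTensorProduct.tprod k (s := fun _ : Fin d => (X ⟶ X))) x T hT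
      refine Subtype.ext (Eq.trans ?_ h1)
      refine (map_sum (divPow k d (X ⟶ X)).subtype _ _).trans ?_
      exact Finset.sum_congr rfl fun S _ => map_zsmul (divPow k d (X ⟶ X)).subtype _ _)
    Finset.univ
  have h1 : gammaPow k d (∑ i, x i) (hS _) = 𝟙 (Gamma.mk X) :=
    Subtype.ext (congrArg (tpure k d) hsum)
  rw [h1] at h
  refine Submodule.span_mono ?_ h
  rintro _ ⟨S, hc, rfl⟩
  obtain ⟨f, g, hf, hg, hfg⟩ := hP S hc
  refine ⟨gammaPow k d f hf, gammaPow k d g hg, gammaPow_mem_part k d f hf,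
    gammaPow_mem_part k d g hg, ?_⟩
  rw [gammaPow_comp k d f hf g hg (hfg ▸ hS S)]
  exact Subtype.ext (congrArg (tpure k d) hfg)

end Gamma

/-! ### Even maps between free supermodules -/

section FreeMaps

variable {k A : Type u} [CommRing k] [Ring A] [Algebra k A] [Superalgebra k A]

/-- The map of free supermodules sending the `i`-th basis vector to the sum of the basis vectors
related to it; it is even if related basis vectors have the same parity. -/
def relMap {ι κ : Type} [Fintype ι] (π : ι → ZMod 2) (ρ : κ → ZMod 2) (r : ι → κ → Prop) :
    (freeMod k A π).carrier →ₗ[Aᵐᵒᵖ] (freeMod k A ρ).carrier := by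
  classical
  exact
  { toFun := fun (v : ι → A) (l : κ) => ∑ i, if r i l then v i else 0
    map_add' := fun (v w : ι → A) => funext fun l => by
      change (∑ i, if r i l then v i + w i else 0) =
        (∑ i, if r i l then v i else 0) + ∑ i, if r i l then w i else 0
      rw [← Finset.sum_add_distrib]
      refine Finset.sum_congr rfl fun i _ => ?_
      split_ifs <;> simp
    map_smul' := fun a (v : ι → A) => funext fun l => by
      change (∑ i, if r i l then a • v i else 0) = a • ∑ i, if r i l then v i else 0
      rw [Finset.smul_sum]
      refine Finset.sum_congr rfl fun i _ => ?_
      split_ifs <;> simp }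

theorem relMap_mem {ι κ : Type} [Fintype ι] {π : ι → ZMod 2} {ρ : κ → ZMod 2}
    {r : ι → κ → Prop} (hr : ∀ i l, r i l → π i = ρ l) :
    relMap π ρ r ∈ part k (M := (freeMod k A π).carrier →ₗ[Aᵐᵒᵖ] (freeMod k A ρ).carrier) 0 := by
  classical
  intro e v hv l
  rw [add_zero]
  refine Submodule.sum_mem _ fun i _ => ?_
  split_ifs with h
  · rw [← hr i l h]; exact hv i
  · exact Submodule.zero_mem _

theorem freeMod_sum_apply {ι γ : Type} (π : ι → ZMod 2) (S : Finset γ)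
    (F : γ → (freeMod k A π).carrier) (i : ι) :
    (∑ c ∈ S, F c : (freeMod k A π).carrier) i = ∑ c ∈ S, (F c : ι → A) i :=
  map_sum (AddMonoidHom.mk' (fun v : (freeMod k A π).carrier => (v : ι → A) i) fun _ _ => rfl) F S

/-- The coordinate projection of `A^π` onto the summands in `S` factors through `A^ρ` when the
basis vectors in `S` can be matched with basis vectors of `A^ρ` of the same parity. -/
theorem relMap_comp_relMap {ι κ : Type} [Fintype ι] [Fintype κ] (π : ι → ZMod 2)
    (ρ : κ → ZMod 2) (S : Finset ι) (j : S → κ) (hj : Function.Injective j) :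
    (relMap ρ π fun l i => ∃ h : i ∈ S, j ⟨i, h⟩ = l).comp
      (relMap π ρ fun i l => ∃ h : i ∈ S, j ⟨i, h⟩ = l) =
      ∑ i ∈ S, relMap (k := k) (A := A) π π (fun i' i'' => i' = i ∧ i'' = i) := by
  classical
  refine LinearMap.ext fun v => funext fun i => ?_
  rw [LinearMap.sum_apply]
  refine Eq.trans ?_ (freeMod_sum_apply π S _ i).symm
  change (∑ l, @ite _ (∃ h : i ∈ S, j ⟨i, h⟩ = l) (Classical.propDecidable _)
      (∑ i', @ite _ (∃ h : i' ∈ S, j ⟨i', h⟩ = l) (Classical.propDecidable _)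
        ((v : ι → A) i') 0) 0) =
    ∑ i₀ ∈ S, ∑ i', @ite _ (i' = i₀ ∧ i = i₀) (Classical.propDecidable _) ((v : ι → A) i') 0
  by_cases hi : i ∈ S
  · rw [Finset.sum_eq_single (j ⟨i, hi⟩), if_pos ⟨hi, rfl⟩, Finset.sum_eq_single i,
      if_pos ⟨hi, rfl⟩, Finset.sum_eq_single i, Finset.sum_eq_single i, if_pos ⟨rfl, rfl⟩]
    · exact fun i' _ h => if_neg fun h' => h h'.1
    · exact fun h => absurd (Finset.mem_univ _) h
    · exact fun i₀ _ h => Finset.sum_eq_zero fun i' _ => if_neg fun h' => h h'.2.symm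
    · exact fun h => absurd hi h
    · exact fun i' _ h => if_neg fun ⟨h1, h2⟩ => h (congrArg Subtype.val (hj h2))
    · exact fun h => absurd (Finset.mem_univ _) h
    · exact fun l _ h => if_neg fun ⟨_, h2⟩ => h h2.symm
    · exact fun h => absurd (Finset.mem_univ _) h
  · refine (Finset.sum_eq_zero fun l _ => if_neg fun h => hi h.1).trans
      (Finset.sum_eq_zero fun i₀ hi₀ => ?_).symm
    exact Finset.sum_eq_zero fun i' _ => if_neg fun h : i' = i₀ ∧ i = i₀ => hi (h.2 ▸ hi₀)

theorem sum_relMap_eq_id {ι : Type} [Fintype ι] (π : ι → ZMod 2) :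
    ∑ i, relMap (k := k) (A := A) π π (fun i' i'' => i' = i ∧ i'' = i) = LinearMap.id := by
  classical
  refine LinearMap.ext fun v => funext fun i => ?_
  rw [LinearMap.sum_apply]
  refine (freeMod_sum_apply π Finset.univ _ i).trans ?_
  change ∑ i₀, (∑ i', @ite _ (i' = i₀ ∧ i = i₀) (Classical.propDecidable _) ((v : ι → A) i') 0) =
    (v : ι → A) i
  rw [Finset.sum_eq_single i, Finset.sum_eq_single i, if_pos ⟨rfl, rfl⟩]
  · exact fun i' _ h => if_neg fun h' => h h'.1
  · exact fun h => absurd (Finset.mem_univ _) h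
  · exact fun i₀ _ h => Finset.sum_eq_zero fun i' _ => if_neg fun h' => h h'.2.symm
  · exact fun h => absurd (Finset.mem_univ _) h

/-- A finitely generated supermodule is an even quotient of a free one: take the homogeneous
components of generators. -/
theorem exists_free_surjection (M : RSMod k A) (hM : Module.Finite Aᵐᵒᵖ M.carrier) :
    ∃ (ι : Type) (_ : Fintype ι) (π : ι → ZMod 2)
      (f : (freeMod k A π).carrier →ₗ[Aᵐᵒᵖ] M.carrier),
      f ∈ part k (M := (freeMod k A π).carrier →ₗ[Aᵐᵒᵖ] M.carrier) 0 ∧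
        Function.Surjective f := by
  classical
  obtain ⟨r, s, hs⟩ := Module.Finite.exists_fin (R := Aᵐᵒᵖ) (M := M.carrier)
  let y : Fin r × ZMod 2 → M.carrier := fun i => proj k i.2 (s i.1)
  let f : (freeMod k A (fun i : Fin r × ZMod 2 => i.2)).carrier →ₗ[Aᵐᵒᵖ] M.carrier :=
    { toFun := fun (v : Fin r × ZMod 2 → A) => ∑ i, MulOpposite.op (v i) • y i
      map_add' := fun (v w : Fin r × ZMod 2 → A) => by
        rw [← Finset.sum_add_distrib]
        exact Finset.sum_congr rfl fun i _ => add_smul _ _ _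
      map_smul' := fun a (v : Fin r × ZMod 2 → A) => by
        rw [RingHom.id_apply, Finset.smul_sum]
        exact Finset.sum_congr rfl fun i _ => mul_smul _ _ _ }
  refine ⟨Fin r × ZMod 2, inferInstance, fun i => i.2, f, ?_, ?_⟩
  · intro e v hv
    refine Submodule.sum_mem _ fun i _ => ?_
    have h := GradedAction.smul_mem (k := k) (e + i.2) i.2
      (MulOpposite.op ((v : Fin r × ZMod 2 → A) i)) (y i) (hv i) (proj_mem _ _)
    rwa [add_assoc, zmod2_add_self] at h
  · have hy : ∀ i, y i ∈ LinearMap.range f := fun i => by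
      refine ⟨(Pi.single i 1 : Fin r × ZMod 2 → A), ?_⟩
      change ∑ l, MulOpposite.op ((Pi.single i 1 : Fin r × ZMod 2 → A) l) • y l = y i
      rw [Finset.sum_eq_single i]
      · rw [Pi.single_eq_same, MulOpposite.op_one, one_smul]
      · intro l _ hl
        rw [Pi.single_eq_of_ne hl, MulOpposite.op_zero, zero_smul]
      · exact fun h => absurd (Finset.mem_univ _) h
    rw [← LinearMap.range_eq_top, eq_top_iff, ← hs, Submodule.span_le]
    rintro _ ⟨i, rfl⟩
    have h := Submodule.add_mem _ (hy (i, 0)) (hy (i, 1))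
    rwa [show y (i, 0) + y (i, 1) = s i from proj_zero_add_proj_one (s i)] at h

/-- The identity of a projective quotient `X` of `A^π` is a sum of even endomorphisms indexed by the
basis of `A^π`. The partial sum over `S` factors through `A^ρ` if the basis vectors in `S` can be
matched with basis vectors of `A^ρ`. -/
theorem exists_sum_eq_id {ι κ : Type} [Fintype ι] [Fintype κ] (π : ι → ZMod 2) (ρ : κ → ZMod 2)
    (X : RSMod k A) (hX : X.IsProjective)
    (f : (freeMod k A π).carrier →ₗ[Aᵐᵒᵖ] X.carrier)
    (hf : f ∈ part k (M := (freeMod k A π).carrier →ₗ[Aᵐᵒᵖ] X.carrier) 0)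
    (hsurj : Function.Surjective f) :
    ∃ x : ι → (X.carrier →ₗ[Aᵐᵒᵖ] X.carrier),
      (∀ i, x i ∈ part k (M := X.carrier →ₗ[Aᵐᵒᵖ] X.carrier) 0) ∧ ∑ i, x i = LinearMap.id ∧
      ∀ (S : Finset ι) (j : S → κ), Function.Injective j → (∀ i, ρ (j i) = π i) →
        ∃ (p : X.carrier →ₗ[Aᵐᵒᵖ] (freeMod k A ρ).carrier)
          (q : (freeMod k A ρ).carrier →ₗ[Aᵐᵒᵖ] X.carrier),
          p ∈ part k (M := X.carrier →ₗ[Aᵐᵒᵖ] (freeMod k A ρ).carrier) 0 ∧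
          q ∈ part k (M := (freeMod k A ρ).carrier →ₗ[Aᵐᵒᵖ] X.carrier) 0 ∧
          q.comp p = ∑ i ∈ S, x i := by
  obtain ⟨h, hh, hfh⟩ := hX (freeMod k A π) X f LinearMap.id hf
    (id_mem_part_hom (k := k) (R := Aᵐᵒᵖ) (M := X.carrier)) hsurj
  have hsum : ∀ S : Finset ι,
      (f.comp (∑ i ∈ S, relMap π π (fun i' i'' => i' = i ∧ i'' = i))).comp h =
        ∑ i ∈ S, (f.comp (relMap π π (fun i' i'' => i' = i ∧ i'' = i))).comp h := fun S => by
    refine LinearMap.ext fun v => ?_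
    simp only [LinearMap.comp_apply, LinearMap.sum_apply, map_sum]
  refine ⟨fun i => (f.comp (relMap π π (fun i' i'' => i' = i ∧ i'' = i))).comp h,
    fun i => ?_, ?_, fun S j hj hρ => ?_⟩
  · have h1 : relMap (k := k) (A := A) π π (fun i' i'' => i' = i ∧ i'' = i) ∈ _ :=
      relMap_mem (by rintro _ _ ⟨rfl, rfl⟩; rfl)
    exact comp_mem_part_hom (k := k) (R := Aᵐᵒᵖ) (i := 0) (j := 0) hh
      (comp_mem_part_hom (k := k) (R := Aᵐᵒᵖ) (i := 0) (j := 0) h1 hf)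
  · rw [← hsum, sum_relMap_eq_id, LinearMap.comp_id, hfh]
  · have h1 : relMap (k := k) (A := A) π ρ (fun i l => ∃ h : i ∈ S, j ⟨i, h⟩ = l) ∈ _ :=
      relMap_mem (by rintro i _ ⟨hi, rfl⟩; exact (hρ ⟨i, hi⟩).symm)
    have h2 : relMap (k := k) (A := A) ρ π (fun l i => ∃ h : i ∈ S, j ⟨i, h⟩ = l) ∈ _ :=
      relMap_mem (by rintro _ i ⟨hi, rfl⟩; exact hρ ⟨i, hi⟩)
    refine ⟨_, _, comp_mem_part_hom (k := k) (R := Aᵐᵒᵖ) (i := 0) (j := 0) hh h1,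
      comp_mem_part_hom (k := k) (R := Aᵐᵒᵖ) (i := 0) (j := 0) h2 hf, ?_⟩
    rw [← hsum, ← relMap_comp_relMap π ρ S j hj]
    rfl

variable {Q : RSMod k A → Prop}

/-- `A^ρ` generates `Γ^d` of a category of projective quotients of free supermodules, provided that
any `d` of the basis vectors that occur can be matched with basis vectors of `A^ρ`. -/
theorem evenlyGenerates_free (d : ℕ) {κ : Type} [Fintype κ] (ρ : κ → ZMod 2)
    (hρ : Q (freeMod k A ρ)) (hproj : ∀ X, Q X → X.IsProjective)
    (hQ : ∀ X : RSMod k A, Q X → ∃ (ι : Type) (_ : Fintype ι) (π : ι → ZMod 2)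
      (f : (freeMod k A π).carrier →ₗ[Aᵐᵒᵖ] X.carrier),
      f ∈ part k (M := (freeMod k A π).carrier →ₗ[Aᵐᵒᵖ] X.carrier) 0 ∧ Function.Surjective f ∧
      ∀ S : Finset ι, S.card ≤ d → ∃ j : S → κ, Function.Injective j ∧ ∀ i, ρ (j i) = π i) :
    EvenlyGenerates k (Gamma.mk ⟨freeMod k A ρ, hρ⟩ : Gamma k d (FullSub Q)) := by
  refine evenlyGenerates_of_mem_span fun ⟨⟨X, hX⟩⟩ => ?_
  obtain ⟨ι, _, π, f, hf, hsurj, hS⟩ := hQ X hX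
  obtain ⟨x, hx, hsum, hfac⟩ := exists_sum_eq_id π ρ X (hproj X hX) f hf hsurj
  refine gamma_id_mem_span k d (C := FullSub Q) (X := ⟨X, hX⟩) (P := ⟨freeMod k A ρ, hρ⟩) x hx hsum
    fun S hc => ?_
  obtain ⟨j, hj, hρπ⟩ := hS S hc
  exact hfac S j hj hρπ

end FreeMaps

end SuperPoly

end

theorem theorem4p3 {k A : Type u} [CommRing k] [Ring A] [Algebra k A]
    [SuperPoly.Superalgebra k A] [Module.Finite k A] [Module.Free k A]
    (m n d : ℕ) (hm : d ≤ m) (hn : d ≤ n) :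
    (SuperPoly.evaluation d (SuperPoly.VCat.free k A m n) :
      SuperPoly.SuperFunctor k (SuperPoly.Rep k (SuperPoly.Gamma k d (SuperPoly.VCat k A)))
        (SuperPoly.LSMod k (SuperPoly.SchurMN k A m n d))).IsSuperEquivalence ∧
    (SuperPoly.evaluation d (SuperPoly.ECat.free k A n) :
      SuperPoly.SuperFunctor k (SuperPoly.Rep k (SuperPoly.Gamma k d (SuperPoly.ECat k A)))
        (SuperPoly.LSMod k (SuperPoly.SchurN k A n d))).IsSuperEquivalence := by
  have inj : ∀ {ι : Type} (S : Finset ι), S.card ≤ d →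
      ∃ t : S → Fin d, Function.Injective t := fun S hS =>
    ⟨fun i => Fin.castLE hS (S.equivFin i),
      (Fin.castLE_injective hS).comp S.equivFin.injective⟩
  constructor
  · refine SuperPoly.evaluation_isSuperEquivalence (SuperPoly.evenlyGenerates_free d _ _
      (fun X hX => hX.2) fun X hX => ?_)
    obtain ⟨ι, hι, π, f, hf, hsurj⟩ := SuperPoly.exists_free_surjection X hX.1
    refine ⟨ι, hι, π, f, hf, hsurj, fun S hS => ?_⟩
    obtain ⟨t, ht⟩ := inj S hS
    -- Even basis vectors go to the first `m` basis vectors of `P`, odd ones to the last `n`.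
    refine ⟨fun i => if π i = 0 then Sum.inl (Fin.castLE hm (t i)) else
      Sum.inr (Fin.castLE hn (t i)), fun a b hab => ?_, fun i => ?_⟩
    · refine ht ?_
      dsimp only at hab
      split_ifs at hab
      · exact Fin.castLE_injective hm (Sum.inl_injective hab)
      · exact Fin.castLE_injective hn (Sum.inr_injective hab)
    · dsimp only
      split_ifs with h
      · exact h.symm
      · exact ((SuperPoly.zmod2_cases (π i)).resolve_left h).symm
  · refine SuperPoly.evaluation_isSuperEquivalence (SuperPoly.evenlyGenerates_free d _ _
      (fun X hX => hX.1.2) fun X hX => ?_)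
    obtain ⟨r, f, hf, hsurj⟩ := hX.2
    refine ⟨Fin r, inferInstance, fun _ => 0, f, hf, hsurj, fun S hS => ?_⟩
    obtain ⟨t, ht⟩ := inj S hS
    exact ⟨fun i => Fin.castLE hn (t i), (Fin.castLE_injective hn).comp ht, fun i => rfl⟩
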